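/- Let $k$ be an algebraically closed field of characteristic $0$ and let $G$ be an affine algebraic group over $k$ (not necessarily reductive or connected). For a group $H$ acting linearly on a finite-dimensional $k$-vector space $V$ through a rational representation of an affine algebraic group, let $V_{\rm reg}=\{v\in V : \dim H\cdot v\ge \dim H\cdot w \text{ for all } w\in V\}$; the codimension-2 condition holds for $(H:V)$ if $\operatorname{codim}_V(V\setminus V_{\rm reg})\ge 2$ (the empty set having codimension $+\infty$). A subgroup $S\subset G$ is a generic isotropy group for $(G:V)$ if there is a dense Zariski open subset $\Omega\subset V$ such that the isotropy groups $G_v$, $v\in\Omega$, are all conjugate in $G$ and $S=G_v$ for some $v\in\Omega$. Theorem. Let $V_1,V_2$ be finite-dimensional rational $G$-modules, and let $V=V_1\oplus V_2$ with the diagonal action of $G$. Suppose that generic isotropy groups $S_i$ for $(G:V_i)$, $i=1,2$, exist, and that the codimension-2 condition holds for both $(S_1:V_2)$ and $(S_2:V_1)$ (the actions being the restrictions of those of $G$). Then the codimension-2 condition holds for $(G:V)$. -/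

import Mathlib

/-! Affine algebraic groups over an algebraically closed field `k`, in classical (point) language. -/

/-- The structure of an affine algebraic group over `k` on an abstract group `G`: a finitely
generated algebra `k[G]` of `k`-valued functions on `G` such that the points of `G` are exactly the
`k`-algebra homomorphisms `k[G] → k`, and such that multiplication `G × G → G` and inversion
`G → G` are morphisms, i.e. pull back regular functions to regular functions
(where `k[G × G]` consists of the finite sums `∑ i, a i x * b i y` with `a i`, `b i` in `k[G]`). -/
class AffineAlgebraicGroup (k G : Type*) [Field k] [Group G] where
  coordRing : Subalgebra k (G → k)
  fg : coordRing.FG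
  eval_bijective : Function.Bijective
    (fun g : G => (Pi.evalAlgHom k (fun _ : G => k) g).comp coordRing.val)
  mul_regular : ∀ f ∈ coordRing, ∃ (n : ℕ) (a b : Fin n → coordRing),
    ∀ x y : G, f (x * y) = ∑ i, (a i : G → k) x * (b i : G → k) y
  inv_regular : ∀ f ∈ coordRing, (fun x : G => f x⁻¹) ∈ coordRing

/-- A linear action of `G` on a vector space `V` is rational if all its matrix coefficients
`g ↦ φ (g • v)` are regular functions on `G`. -/
def IsRationalAction (k G V : Type*) [Field k] [Group G] [AffineAlgebraicGroup k G]
    [AddCommGroup V] [Module k V] [DistribMulAction G V] : Prop :=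
  ∀ (φ : Module.Dual k V) (v : V),
    (fun g : G => φ (g • v)) ∈ AffineAlgebraicGroup.coordRing (k := k) (G := G)

section Zariski

/-- The algebra `k[V]` of polynomial functions on `V`: generated by the linear functionals. -/
def regularFunctions (k V : Type*) [Field k] [AddCommGroup V] [Module k V] :
    Subalgebra k (V → k) :=
  Algebra.adjoin k (Set.range fun φ : Module.Dual k V => (φ : V → k))

/-- Zariski open subsets of `V`: complements of the zero loci of sets of polynomial functions. -/
def IsZariskiOpen (k : Type*) {V : Type*} [Field k] [AddCommGroup V] [Module k V]
    (U : Set V) : Prop :=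
  ∃ P : Set (V → k), P ⊆ regularFunctions k V ∧ Uᶜ = {v | ∀ f ∈ P, f v = 0}

/-- Zariski dense subsets of `V`: those that meet every nonempty Zariski open subset. -/
def IsZariskiDense (k : Type*) {V : Type*} [Field k] [AddCommGroup V] [Module k V]
    (X : Set V) : Prop :=
  ∀ U : Set V, IsZariskiOpen k U → U.Nonempty → (X ∩ U).Nonempty

/-- The algebra of restrictions to `X ⊆ V` of the polynomial functions on `V`; it is `k[V] / I(X)`,
the coordinate ring of the Zariski closure of `X`. -/
def restrictedRegularFunctions (k : Type*) {V : Type*} [Field k] [AddCommGroup V] [Module k V]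
    (X : Set V) : Subalgebra k (X → k) :=
  (regularFunctions k V).map
    (AlgHom.pi (fun x : X => Pi.evalAlgHom k (fun _ : V => k) (x : V)))

/-- The dimension of `X ⊆ V`, i.e. the Krull dimension of the coordinate ring `k[V] / I(X)` of its
Zariski closure (`⊥` if `X` is empty). For Zariski locally closed subsets, such as orbits of
algebraic groups, this is the dimension as a variety. -/
noncomputable def zariskiDim (k : Type*) {V : Type*} [Field k] [AddCommGroup V] [Module k V]
    (X : Set V) : WithBot ℕ∞ :=
  ringKrullDim (restrictedRegularFunctions k X)

end Zariski

section Actions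

/-- The set `V_reg` of `H`-regular elements of `V`: those whose orbit has maximal dimension. -/
def regularElements (k H V : Type*) [Field k] [AddCommGroup V] [Module k V]
    [Group H] [MulAction H V] : Set V :=
  {v | ∀ w : V, zariskiDim k (MulAction.orbit H w) ≤ zariskiDim k (MulAction.orbit H v)}

/-- The codimension-`n` condition for `(H : V)`: `codim_V (V \ V_reg) ≥ n`, written as
`dim (V \ V_reg) + n ≤ dim V` (so it holds if `V \ V_reg` is empty). -/
def CodimensionCondition (n : ℕ) (k H V : Type*) [Field k] [AddCommGroup V] [Module k V]
    [Group H] [MulAction H V] : Prop :=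
  zariskiDim k (regularElements k H V)ᶜ + n ≤ (Module.finrank k V : WithBot ℕ∞)

/-- The subgroup `S` of `G` is a generic isotropy group for `(G : V)`: there is a dense Zariski open
subset `Ω` of `V` such that all isotropy groups `G_v`, `v ∈ Ω`, are conjugate in `G`, and `S` is one
of them. -/
def IsGenericIsotropyGroup (k : Type*) {G : Type*} (V : Type*) [Field k] [AddCommGroup V]
    [Module k V] [Group G] [MulAction G V] (S : Subgroup G) : Prop :=
  ∃ Ω : Set V, IsZariskiOpen k Ω ∧ IsZariskiDense k Ω ∧
    (∀ v ∈ Ω, ∀ w ∈ Ω, ∃ g : G,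
      (MulAction.stabilizer G v).map (MulAut.conj g).toMonoidHom = MulAction.stabilizer G w) ∧
    ∃ v ∈ Ω, S = MulAction.stabilizer G v

end Actions

/-!
In characteristic `0` the dimension of an orbit `H • v` is the rank of the differential at `1` of
the orbit map `H → V`, restricted to the tangent space `T₁H`, and the kernel of this restriction is
the tangent space of the stabilizer of `v`. Hence `v ↦ dim H • v` is lower semicontinuous, and
`dim G • (x, y) = dim G • x + dim Gₓ • y`. If `Gₓ` is conjugate to the generic isotropy group `S₁`,
this shows that `(x, y)` is `G`-regular as soon as a suitable translate of `y` is `S₁`-regular.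

If the complement of the `G`-regular points had codimension at most `1`, it would contain the zero
set of a nonconstant polynomial function `f` on `V₁ × V₂`, which depends on one of the two
variables, say the second. For generic `x` the function `f (x, ·)` is then still nonconstant, and a
translate of its zero set is a hypersurface of `V₂` without `S₁`-regular points, which the
codimension-2 condition for `(S₁ : V₂)` excludes.
-/

section KrullDimension

theorem add_natCast_le_of_forall_natCast_le {a b : WithBot ℕ∞} (m : ℕ)
    (h : ∀ n : ℕ, n ≤ a → (n + m : ℕ) ≤ b) : a + m ≤ b := by
  induction a with
  | bot => simp
  | coe a =>
    have hb : (0 + m : ℕ) ≤ b := h 0 (WithBot.coe_le_coe.2 (zero_le (a := a)))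
    lift b to ℕ∞ using fun hb' => by simp [hb'] at hb
    induction a with
    | top =>
      have hb : b = ⊤ := ENat.eq_top_iff_forall_ge.2 fun n => by
        have := h n (WithBot.coe_le_coe.2 le_top)
        exact le_trans (by simp) (WithBot.coe_le_coe.1 this)
      simp [hb]
    | coe n => exact_mod_cast h n le_rfl

theorem ringKrullDim_le_of_isIntegral (R S : Type*) [CommRing R] [CommRing S] [Algebra R S]
    [Algebra.IsIntegral R S] : ringKrullDim S ≤ ringKrullDim R :=
  Order.krullDim_le_of_strictMono (PrimeSpectrum.comap (algebraMap R S))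
    fun _ _ hpq => Ideal.IsIntegral.comap_lt_comap hpq

theorem ringKrullDim_eq_of_isIntegral (R S : Type*) [CommRing R] [CommRing S] [Algebra R S]
    [Algebra.IsIntegral R S] [FaithfulSMul R S] : ringKrullDim S = ringKrullDim R := by
  refine le_antisymm (ringKrullDim_le_of_isIntegral R S) (iSup_le fun l => ?_)
  obtain ⟨P, _, _⟩ := (Ideal.nonempty_primesOver (S := S) l.head.asIdeal).some
  obtain ⟨L, hL, -⟩ := Ideal.exists_ltSeries_of_hasGoingUp l P
  exact Order.le_krullDim_iff.2 ⟨L, hL⟩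

theorem exists_minimalPrimes_le_ringKrullDim_quotient {R : Type*} [CommRing R] {I : Ideal R}
    {n : ℕ} (h : n ≤ ringKrullDim (R ⧸ I)) :
    ∃ p ∈ I.minimalPrimes, n ≤ ringKrullDim (R ⧸ p) := by
  rw [ringKrullDim_quotient] at h
  obtain ⟨l, hl⟩ := Order.le_krullDim_iff.1 h
  obtain ⟨p, hp, hpl⟩ := Ideal.exists_minimalPrimes_le (I := I) (J := l.head.1.asIdeal) l.head.2
  refine ⟨p, hp, ?_⟩
  rw [ringKrullDim_quotient]
  exact Order.le_krullDim_iff.2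
    ⟨⟨l.length, fun i => ⟨(l i).1, hpl.trans (l.head_le i)⟩, fun i => l.step i⟩, hl⟩

theorem ringKrullDim_quotient_add_two_le {R : Type*} [CommRing R] [IsDomain R]
    [UniqueFactorizationMonoid R] {p : Ideal R} [p.IsPrime]
    (hp : ∀ f, Prime f → ¬ p ≤ Ideal.span {f}) (hne : p ≠ ⊥) :
    ringKrullDim (R ⧸ p) + 2 ≤ ringKrullDim R := by
  obtain ⟨f, hfp, hf⟩ := Ideal.IsPrime.exists_mem_prime_of_ne_bot ‹_› hne
  obtain ⟨g, hgp, hgf⟩ := SetLike.not_le_iff_exists.1 (hp f hf)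
  have : (Ideal.span {f}).IsPrime := (Ideal.span_singleton_prime hf.ne_zero).2 hf
  have hle : Ideal.span {f} ≤ p := (Ideal.span_singleton_le_iff_mem _).2 hfp
  have hpf : ringKrullDim (R ⧸ p) + 1 ≤ ringKrullDim (R ⧸ Ideal.span {f}) := by
    refine ringKrullDim_succ_le_of_surjective (Ideal.Quotient.factor hle)
      (Ideal.Quotient.factor_surjective hle) (r := Ideal.Quotient.mk _ g)
      (mem_nonZeroDivisors_of_ne_zero ?_) ?_
    · rwa [Ne, Ideal.Quotient.eq_zero_iff_mem]
    · rwa [Ideal.Quotient.factor_mk, Ideal.Quotient.eq_zero_iff_mem]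
  calc ringKrullDim (R ⧸ p) + 2 = ringKrullDim (R ⧸ p) + 1 + 1 := by
        rw [add_assoc, one_add_one_eq_two]
    _ ≤ ringKrullDim (R ⧸ Ideal.span {f}) + 1 := by gcongr
    _ ≤ ringKrullDim R := ringKrullDim_quotient_succ_le_of_nonZeroDivisor
        (mem_nonZeroDivisors_of_ne_zero hf.ne_zero)

theorem exists_prime_forall_dvd_of_not_ringKrullDim_quotient_add_two_le {R : Type*} [CommRing R]
    [IsDomain R] [UniqueFactorizationMonoid R] {I : Ideal R} (hI : I ≠ ⊥)
    (hdim : ¬ ringKrullDim (R ⧸ I) + 2 ≤ ringKrullDim R) :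
    ∃ f, Prime f ∧ ∀ g ∈ I, f ∣ g := by
  by_contra! hf
  refine hdim (add_natCast_le_of_forall_natCast_le 2 fun n hn => ?_)
  obtain ⟨p, hp, hnp⟩ := exists_minimalPrimes_le_ringKrullDim_quotient hn
  have hIp : I ≤ p := hp.1.2
  have : p.IsPrime := hp.1.1
  have hpf : ∀ f, Prime f → ¬ p ≤ Ideal.span {f} := by
    intro f hf' hpf
    obtain ⟨g, hg, hfg⟩ := hf f hf'
    exact hfg (Ideal.mem_span_singleton.1 (hpf (hIp hg)))
  calc ((n + 2 : ℕ) : WithBot ℕ∞) = n + 2 := by norm_cast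
    _ ≤ ringKrullDim (R ⧸ p) + 2 := by gcongr
    _ ≤ ringKrullDim R := ringKrullDim_quotient_add_two_le hpf (ne_bot_of_le_ne_bot hI hIp)

theorem ringKrullDim_mvPolynomial_field (k ι : Type*) [Field k] [Finite ι] :
    ringKrullDim (MvPolynomial ι k) = Nat.card ι := by
  rw [MvPolynomial.ringKrullDim_of_isNoetherianRing, ringKrullDim_eq_zero_of_field, zero_add]

theorem ringKrullDim_eq_toNat_trdeg (k A : Type*) [Field k] [CommRing A] [IsDomain A]
    [Algebra k A] [Algebra.FiniteType k A] :
    ringKrullDim A = (Algebra.trdeg k A).toNat := by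
  obtain ⟨s, g, hg, hint⟩ := exists_integral_inj_algHom_of_fg k A
  let _ := g.toRingHom.toAlgebra
  have : Algebra.IsIntegral (MvPolynomial (Fin s) k) A := ⟨hint⟩
  have : IsScalarTower k (MvPolynomial (Fin s) k) A :=
    IsScalarTower.of_algebraMap_eq fun x => (g.commutes x).symm
  have : FaithfulSMul (MvPolynomial (Fin s) k) A :=
    (faithfulSMul_iff_algebraMap_injective _ _).2 hg
  have hX := (IsTranscendenceBasis.mvPolynomial (Fin s) k).algebraMap_comp (A := A)
  have hs : (Algebra.trdeg k A).toNat = s := by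
    rw [← Cardinal.toNat_lift, ← hX.lift_cardinalMk_eq_trdeg]
    simp
  rw [ringKrullDim_eq_of_isIntegral (MvPolynomial (Fin s) k), ringKrullDim_mvPolynomial_field, hs,
    Nat.card_fin]

variable {k A : Type*} [Field k] [CommRing A] [IsDomain A] [Algebra k A] [Algebra.FiniteType k A]

theorem natCast_le_ringKrullDim_of_algebraicIndependent {n : ℕ} {c : Fin n → A}
    (hc : AlgebraicIndependent k c) : n ≤ ringKrullDim A := by
  have hn := hc.lift_cardinalMk_le_trdeg
  have := Cardinal.toNat_le_toNat hn
    (Cardinal.lift_lt_aleph0.2 (trdeg_lt_aleph0_of_finiteType (R := k)))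
  rw [ringKrullDim_eq_toNat_trdeg k]
  exact_mod_cast (by simpa using this)

theorem exists_algebraicIndependent_of_natCast_le_ringKrullDim {n : ℕ} (h : n ≤ ringKrullDim A)
    {s : Set A} (hs : Algebra.adjoin k s = ⊤) :
    ∃ c : Fin n → A, (∀ i, c i ∈ s) ∧ AlgebraicIndependent k c := by
  have : Algebra.IsAlgebraic (Algebra.adjoin k s) A :=
    ⟨fun a => isAlgebraic_algebraMap (⟨a, hs ▸ Algebra.mem_top⟩ : Algebra.adjoin k s)⟩
  obtain ⟨t, hts, ht⟩ := exists_isTranscendenceBasis_subset (R := k) s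
  have hcard : Cardinal.mk t = Algebra.trdeg k A := ht.cardinalMk_eq_trdeg
  have : Finite t := Cardinal.lt_aleph0_iff_finite.1
    (hcard ▸ trdeg_lt_aleph0_of_finiteType)
  have hn : n ≤ Nat.card t := by
    rw [ringKrullDim_eq_toNat_trdeg k, ← hcard] at h
    exact_mod_cast h
  let e : Fin n ↪ t := (Fin.castLEEmb hn).trans (Finite.equivFin t).symm.toEmbedding
  exact ⟨fun i => e i, fun i => hts (e i).2, ht.1.comp e e.injective⟩

end KrullDimension

section PolynomialRings

open MvPolynomial

variable {k ι : Type*} [Field k]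

/-- Translation by `a`, as an automorphism of the polynomial ring; it moves the points of affine
space transitively. -/
noncomputable def translateAlgEquiv (a : ι → k) : MvPolynomial ι k ≃ₐ[k] MvPolynomial ι k :=
  AlgEquiv.ofAlgHom (aeval fun i => X i + C (a i)) (aeval fun i => X i - C (a i))
    (by ext; simp [algHom_C]) (by ext; simp [algHom_C])

theorem aeval_translateAlgEquiv (a x : ι → k) (p : MvPolynomial ι k) :
    aeval x (translateAlgEquiv a p) = aeval (x + a) p := by
  change ((aeval x).comp (aeval fun i => X i + C (a i))) p = aeval (x + a) p
  congr 1
  ext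
  simp

theorem comap_translateAlgEquiv_vanishingIdeal_singleton (a x : ι → k) :
    (vanishingIdeal k {x}).comap (translateAlgEquiv a).toRingEquiv =
      vanishingIdeal k {x + a} := by
  ext p
  rw [Ideal.mem_comap, mem_vanishingIdeal_singleton_iff, mem_vanishingIdeal_singleton_iff,
    ← aeval_translateAlgEquiv]
  rfl

theorem isUnit_iff_forall_eval_eq [Infinite k] {f : MvPolynomial ι k} (hf : f ≠ 0) :
    IsUnit f ↔ ∀ x y, eval x f = eval y f := by
  rw [isUnit_iff_eq_C_of_isReduced]
  refine ⟨?_, fun h => ?_⟩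
  · rintro ⟨r, -, rfl⟩ x y
    rw [eval_C, eval_C]
  · have hC : f = C (eval 0 f) := MvPolynomial.funext fun x => by rw [eval_C, h x 0]
    exact ⟨_, isUnit_iff_ne_zero.2 fun h0 => hf (by rw [hC, h0, C_0]), hC⟩

variable [Finite ι] [IsAlgClosed k]

theorem height_vanishingIdeal_singleton (x : ι → k) :
    (vanishingIdeal k {x}).height = Nat.card ι := by
  have : FiniteRingKrullDim (MvPolynomial ι k) := by
    rw [finiteRingKrullDim_iff_ne_bot_and_top, ringKrullDim_mvPolynomial_field]
    exact ⟨WithBot.natCast_ne_bot _, fun h =>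
      ENat.natCast_ne_top _ (WithBot.coe_injective h)⟩
  obtain ⟨m, hm, hmh⟩ := Ideal.exists_isMaximal_height (R := MvPolynomial ι k)
  obtain ⟨y, rfl⟩ := isMaximal_iff_eq_vanishingIdeal_singleton.1 hm
  have hxy := comap_translateAlgEquiv_vanishingIdeal_singleton (y - x) x
  rw [add_sub_cancel] at hxy
  rw [← hxy, RingEquiv.height_comap, ringKrullDim_mvPolynomial_field] at hmh
  exact_mod_cast hmh

theorem card_le_ringKrullDim_quotient_span_singleton_add_one {f : MvPolynomial ι k}
    (hf : ¬ IsUnit f) :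
    Nat.card ι ≤ ringKrullDim (MvPolynomial ι k ⧸ Ideal.span {f}) + 1 := by
  obtain ⟨m, hm, hfm⟩ := Ideal.exists_le_maximal (Ideal.span {f})
    (by rwa [Ne, Ideal.span_singleton_eq_top])
  obtain ⟨x, rfl⟩ := isMaximal_iff_eq_vanishingIdeal_singleton.1 hm
  have h := Ideal.height_le_ringKrullDim_quotient_add_one
    ((Ideal.span_singleton_le_iff_mem _).1 hfm)
  rw [height_vanishingIdeal_singleton] at h
  exact_mod_cast h

theorem card_le_ringKrullDim_quotient_vanishingIdeal_add_one {S : Set (ι → k)}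
    {f : MvPolynomial ι k} (hf : ¬ IsUnit f) (hS : zeroLocus k (Ideal.span {f}) ⊆ S) :
    Nat.card ι ≤ ringKrullDim (MvPolynomial ι k ⧸ vanishingIdeal k S) + 1 := by
  have hle : vanishingIdeal k S ≤ (Ideal.span {f}).radical := by
    rw [← vanishingIdeal_zeroLocus_eq_radical (K := k)]
    exact vanishingIdeal_anti_mono hS
  refine (card_le_ringKrullDim_quotient_span_singleton_add_one hf).trans ?_
  rw [ringKrullDim_quotient, ← PrimeSpectrum.zeroLocus_radical, ← ringKrullDim_quotient]
  gcongr
  exact ringKrullDim_le_of_surjective _ (Ideal.Quotient.factor_surjective hle)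

end PolynomialRings

section RegularFunctions

variable {k V W : Type*} [Field k] [AddCommGroup V] [Module k V] [AddCommGroup W] [Module k W]

theorem dual_mem_regularFunctions (φ : Module.Dual k V) : (φ : V → k) ∈ regularFunctions k V :=
  Algebra.subset_adjoin ⟨φ, rfl⟩

theorem comp_affine_mem_regularFunctions (L : W →ₗ[k] V) (c : V) {f : V → k}
    (hf : f ∈ regularFunctions k V) : (fun w => f (L w + c)) ∈ regularFunctions k W := by
  induction hf using Algebra.adjoin_induction with
  | mem x hx =>
    obtain ⟨φ, rfl⟩ := hx
    have hφ : (fun w => φ (L w + c)) =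
        (φ ∘ₗ L : Module.Dual k W) + algebraMap k (W → k) (φ c) := by
      ext w; simp
    simp only [hφ]
    exact add_mem (dual_mem_regularFunctions _) (Subalgebra.algebraMap_mem _ _)
  | algebraMap r => exact Subalgebra.algebraMap_mem (regularFunctions k W) r
  | add x y _ _ hx hy => exact add_mem hx hy
  | mul x y _ _ hx hy => exact mul_mem hx hy

theorem comp_linear_mem_regularFunctions (L : W →ₗ[k] V) {f : V → k}
    (hf : f ∈ regularFunctions k V) : (fun w => f (L w)) ∈ regularFunctions k W := by
  simpa using comp_affine_mem_regularFunctions L 0 hf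

theorem isZariskiOpen_iff_forall_exists {U : Set V} :
    IsZariskiOpen k U ↔ ∀ v ∈ U, ∃ f ∈ regularFunctions k V, f v ≠ 0 ∧ ∀ w, f w ≠ 0 → w ∈ U := by
  constructor
  · rintro ⟨P, hP, hU⟩ v hv
    have hmem (w : V) : w ∈ U ↔ ∃ f ∈ P, f w ≠ 0 := by
      simpa using (Set.ext_iff.1 hU w).not
    obtain ⟨f, hf, hfv⟩ := (hmem v).1 hv
    exact ⟨f, hP hf, hfv, fun w hw => (hmem w).2 ⟨f, hf, hw⟩⟩
  · intro h
    refine ⟨{f | f ∈ regularFunctions k V ∧ ∀ w, f w ≠ 0 → w ∈ U}, fun f hf => hf.1, ?_⟩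
    ext v
    refine ⟨fun hv f hf => by_contra fun hfv => hv (hf.2 v hfv), fun hv hvU => ?_⟩
    obtain ⟨f, hf, hfv, hfU⟩ := h v hvU
    exact hfv (hv f ⟨hf, hfU⟩)

theorem isZariskiOpen_preimage_affine (L : W →ₗ[k] V) (c : V) {U : Set V}
    (hU : IsZariskiOpen k U) : IsZariskiOpen k {w | L w + c ∈ U} := by
  rw [isZariskiOpen_iff_forall_exists] at hU ⊢
  intro w hw
  obtain ⟨f, hf, hfw, hfU⟩ := hU _ hw
  exact ⟨_, comp_affine_mem_regularFunctions L c hf, hfw, fun w' hw' => hfU _ hw'⟩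

open MvPolynomial

variable [FiniteDimensional k V]

variable (k V) in
/-- The polynomial function on `V` defined by a polynomial in the coordinates of a fixed basis. -/
noncomputable def polynomialFunction : MvPolynomial (Fin (Module.finrank k V)) k →ₐ[k] (V → k) :=
  aeval fun i v => (Module.finBasis k V).equivFun v i

theorem polynomialFunction_apply (p : MvPolynomial (Fin (Module.finrank k V)) k) (v : V) :
    polynomialFunction k V p v = eval ((Module.finBasis k V).equivFun v) p := by
  change ((Pi.evalAlgHom k (fun _ : V => k) v).comp (polynomialFunction k V)) p =
    aeval ((Module.finBasis k V).equivFun v) p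
  congr 1
  ext i
  simp [polynomialFunction]

theorem range_polynomialFunction : (polynomialFunction k V).range = regularFunctions k V := by
  rw [polynomialFunction, ← Algebra.adjoin_range_eq_range_aeval]
  apply le_antisymm
  · apply Algebra.adjoin_mono
    rintro _ ⟨i, rfl⟩
    exact ⟨(Module.finBasis k V).coord i, rfl⟩
  · apply Algebra.adjoin_le
    rintro _ ⟨φ, rfl⟩
    have hφ : (φ : V → k) = ∑ i, φ (Module.finBasis k V i) •
        (fun v => (Module.finBasis k V).equivFun v i : V → k) := by
      ext v
      conv_lhs => rw [← (Module.finBasis k V).sum_equivFun v]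
      simp only [map_sum, map_smul, Finset.sum_apply, Pi.smul_apply, smul_eq_mul, mul_comm]
    beta_reduce
    rw [hφ]
    exact sum_mem fun i _ => Subalgebra.smul_mem _ (Algebra.subset_adjoin (Set.mem_range_self i)) _

theorem mem_vanishingIdeal_image_equivFun_iff {p : MvPolynomial (Fin (Module.finrank k V)) k}
    {X : Set V} : p ∈ vanishingIdeal k ((Module.finBasis k V).equivFun '' X) ↔
      ∀ v ∈ X, polynomialFunction k V p v = 0 := by
  simp [mem_vanishingIdeal_iff, polynomialFunction_apply]

theorem zariskiDim_eq_ringKrullDim (X : Set V) :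
    zariskiDim k X = ringKrullDim (MvPolynomial (Fin (Module.finrank k V)) k ⧸
      vanishingIdeal k ((Module.finBasis k V).equivFun '' X)) := by
  set restrict := (AlgHom.pi (fun x : X => Pi.evalAlgHom k (fun _ : V => k) (x : V))).comp
    (polynomialFunction k V)
  have hrange : restrictedRegularFunctions k X = restrict.range := by
    rw [restrictedRegularFunctions, ← range_polynomialFunction, AlgHom.range_comp]
  have hker : RingHom.ker restrict.rangeRestrict =
      vanishingIdeal k ((Module.finBasis k V).equivFun '' X) := by
    ext p
    rw [AlgHom.ker_rangeRestrict, RingHom.mem_ker, mem_vanishingIdeal_image_equivFun_iff,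
      funext_iff]
    exact Subtype.forall
  rw [zariskiDim, hrange, ← hker]
  exact (ringKrullDim_eq_of_ringEquiv (Ideal.quotientKerAlgEquivOfSurjective
    restrict.rangeRestrict_surjective).toRingEquiv).symm

theorem exists_mem_vanishingIdeal_polynomialFunction_ne_zero {Z : Set V}
    (hZ : IsZariskiOpen k Zᶜ) {v : V} (hv : v ∉ Z) :
    ∃ p ∈ vanishingIdeal k ((Module.finBasis k V).equivFun '' Z),
      polynomialFunction k V p v ≠ 0 := by
  obtain ⟨f, hf, hfv, hfZ⟩ := isZariskiOpen_iff_forall_exists.1 hZ v hv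
  rw [← range_polynomialFunction] at hf
  obtain ⟨p, rfl⟩ := hf
  exact ⟨p, mem_vanishingIdeal_image_equivFun_iff.2 fun w hw => by_contra fun h => hfZ w h hw, hfv⟩

theorem isUnit_iff_forall_polynomialFunction_eq [Infinite k]
    {p : MvPolynomial (Fin (Module.finrank k V)) k} (hp : p ≠ 0) :
    IsUnit p ↔ ∀ v w, polynomialFunction k V p v = polynomialFunction k V p w := by
  simp only [isUnit_iff_forall_eval_eq hp, polynomialFunction_apply,
    (Module.finBasis k V).equivFun.surjective.forall]

variable [IsAlgClosed k]

theorem exists_zero_subset_of_not_zariskiDim_add_two_le {Z : Set V} (hZ : IsZariskiOpen k Zᶜ)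
    (hne : Zᶜ.Nonempty) (hdim : ¬ zariskiDim k Z + 2 ≤ (Module.finrank k V : WithBot ℕ∞)) :
    ∃ f ∈ regularFunctions k V, (∃ v w, f v ≠ f w) ∧ ∀ v, f v = 0 → v ∈ Z := by
  have hI : vanishingIdeal k ((Module.finBasis k V).equivFun '' Z) ≠ ⊥ := by
    obtain ⟨v, hv⟩ := hne
    obtain ⟨p, hp, hpv⟩ := exists_mem_vanishingIdeal_polynomialFunction_ne_zero hZ hv
    exact (Submodule.ne_bot_iff _).2 ⟨p, hp, fun h0 => hpv (by rw [h0, map_zero, Pi.zero_apply])⟩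
  obtain ⟨f, hf, hfd⟩ :=
    exists_prime_forall_dvd_of_not_ringKrullDim_quotient_add_two_le hI (by
      rwa [ringKrullDim_mvPolynomial_field, Nat.card_fin, ← zariskiDim_eq_ringKrullDim])
  refine ⟨polynomialFunction k V f, range_polynomialFunction.le ⟨f, rfl⟩, ?_, fun v hv => ?_⟩
  · simpa [isUnit_iff_forall_polynomialFunction_eq hf.ne_zero] using hf.not_isUnit
  · by_contra hvZ
    obtain ⟨p, hp, hpv⟩ := exists_mem_vanishingIdeal_polynomialFunction_ne_zero hZ hvZ
    obtain ⟨q, rfl⟩ := hfd p hp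
    exact hpv (by rw [map_mul, Pi.mul_apply, hv, zero_mul])

theorem not_zariskiDim_add_two_le_of_zero_subset {Y : Set V} {f : V → k}
    (hf : f ∈ regularFunctions k V) (hne : ∃ v w, f v ≠ f w) (hY : ∀ v, f v = 0 → v ∈ Y) :
    ¬ zariskiDim k Y + 2 ≤ (Module.finrank k V : WithBot ℕ∞) := by
  rw [← range_polynomialFunction] at hf
  obtain ⟨p, rfl⟩ := hf
  have hunit : ¬ IsUnit p := fun hu => by
    obtain ⟨v, w, hvw⟩ := hne
    exact hvw ((isUnit_iff_forall_polynomialFunction_eq hu.ne_zero).1 hu v w)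
  have hzero : zeroLocus k (Ideal.span {p}) ⊆ (Module.finBasis k V).equivFun '' Y := by
    intro x hx
    obtain ⟨v, rfl⟩ := (Module.finBasis k V).equivFun.surjective x
    refine ⟨v, hY v ?_, rfl⟩
    exact (polynomialFunction_apply p v).trans (hx p (Ideal.mem_span_singleton_self p))
  intro hdim
  have hcard := card_le_ringKrullDim_quotient_vanishingIdeal_add_one hunit hzero
  rw [← zariskiDim_eq_ringKrullDim, Nat.card_fin] at hcard
  have : (Module.finrank k V : WithBot ℕ∞) + 1 ≤ Module.finrank k V :=
    calc (Module.finrank k V : WithBot ℕ∞) + 1 ≤ zariskiDim k Y + 1 + 1 := by gcongr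
      _ = zariskiDim k Y + 2 := by rw [add_assoc, one_add_one_eq_two]
      _ ≤ Module.finrank k V := hdim
  exact absurd this (by exact_mod_cast (Nat.lt_succ_self _).not_ge)

end RegularFunctions

section Derivations

theorem exists_notMem_forall_mul_eq_zero_of_mem_minimalPrimes {B : Type*} [CommRing B]
    [IsReduced B] [IsNoetherianRing B] {P : Ideal B} (hP : P ∈ minimalPrimes B) :
    ∃ s ∉ P, ∀ a ∈ P, s * a = 0 := by
  have htop : (⊥ : Submodule B B).colon {(1 : B)} = ⊥ := by
    ext a
    simp [Submodule.mem_colon_singleton]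
  obtain ⟨s, rfl⟩ : ∃ s : B, P = (⊥ : Submodule B B).colon {s} :=
    Submodule.exists_eq_colon_of_mem_minimalPrimes (x := 1) (by rwa [htop])
  have hmem (a : B) : a ∈ (⊥ : Submodule B B).colon {s} ↔ a * s = 0 := by
    simp [Submodule.mem_colon_singleton]
  refine ⟨s, fun hs => hP.1.1.ne_top ?_, fun a ha => by rw [mul_comm, (hmem a).1 ha]⟩
  have hs0 : s = 0 := (pow_eq_zero_iff two_ne_zero).1 ((sq s).trans ((hmem s).1 hs))
  rw [Ideal.eq_top_iff_one, hmem, hs0, mul_zero]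

theorem derivation_mem_of_mem_minimalPrimes {k B : Type*} [CommRing k] [CommRing B] [Algebra k B]
    [IsReduced B] [IsNoetherianRing B] (D : Derivation k B B) {P : Ideal B}
    (hP : P ∈ minimalPrimes B) {a : B} (ha : a ∈ P) : D a ∈ P := by
  obtain ⟨s, hs, hsP⟩ := exists_notMem_forall_mul_eq_zero_of_mem_minimalPrimes hP
  have hleibniz : s * D a + a * D s = 0 := by
    simpa [hsP a ha] using (D.leibniz s a).symm
  have hsD : s * D a ∈ P := by
    rw [eq_neg_of_add_eq_zero_left hleibniz]
    exact neg_mem (Ideal.mul_mem_right _ _ ha)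
  exact (hP.1.1.mem_or_mem hsD).resolve_left hs

theorem derivation_aeval {k B M σ : Type*} [CommRing k] [CommRing B] [Algebra k B] [Fintype σ]
    [AddCommGroup M] [Module B M] [Module k M] [IsScalarTower k B M] (D : Derivation k B M)
    (c : σ → B) (p : MvPolynomial σ k) :
    D (MvPolynomial.aeval c p) =
      ∑ i, MvPolynomial.aeval c (MvPolynomial.pderiv i p) • D (c i) := by
  classical
  induction p using MvPolynomial.induction_on with
  | C r => simp
  | add p q hp hq => simp [hp, hq, add_smul, Finset.sum_add_distrib]
  | mul_X p j hp =>
    have hX (i : σ) : MvPolynomial.aeval c (MvPolynomial.pderiv i (MvPolynomial.X (R := k) j)) •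
        D (c i) = if i = j then D (c i) else 0 := by
      rw [MvPolynomial.pderiv_X]
      split_ifs with h
      · simp [h]
      · simp [Ne.symm h]
    simp only [map_mul, MvPolynomial.aeval_X, D.leibniz, hp, Derivation.leibniz, smul_eq_mul,
      map_add, add_smul, Finset.sum_add_distrib, mul_smul, ← Finset.smul_sum, hX,
      Finset.sum_ite_eq', Finset.mem_univ, if_true]

theorem totalDegree_pderiv_lt {k σ : Type*} [CommRing k] {p : MvPolynomial σ k}
    (hp : p.totalDegree ≠ 0) (i : σ) :
    (MvPolynomial.pderiv i p).totalDegree < p.totalDegree := by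
  rw [MvPolynomial.totalDegree, Finset.sup_lt_iff (Nat.pos_of_ne_zero hp)]
  intro d hd
  rw [MvPolynomial.mem_support_iff, MvPolynomial.coeff_pderiv] at hd
  refine lt_of_lt_of_le ?_
    (MvPolynomial.le_totalDegree (MvPolynomial.mem_support_iff.2 (left_ne_zero_of_mul hd)))
  change d.degree < (d + Finsupp.single i 1).degree
  simp

theorem exists_pderiv_ne_zero {k σ : Type*} [CommRing k] [NoZeroDivisors k] [CharZero k]
    {p : MvPolynomial σ k} (hp : p.totalDegree ≠ 0) : ∃ i, MvPolynomial.pderiv i p ≠ 0 := by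
  classical
  obtain ⟨m, hm, hm0⟩ : ∃ m ∈ p.support, m ≠ 0 := by
    by_contra! h
    exact hp ((MvPolynomial.totalDegree_eq_zero_iff (p := p)).2 fun m hm => by simp [h m hm])
  obtain ⟨i, hi⟩ := Finsupp.ne_iff.1 hm0
  have hmi : m - Finsupp.single i 1 + Finsupp.single i 1 = m :=
    tsub_add_cancel_of_le (Finsupp.single_le_iff.2 (Nat.one_le_iff_ne_zero.2 hi))
  refine ⟨i, fun h0 => ?_⟩
  have hcoeff := congrArg (MvPolynomial.coeff (m - Finsupp.single i 1)) h0
  rw [MvPolynomial.coeff_pderiv, MvPolynomial.coeff_zero, hmi] at hcoeff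
  exact (mul_eq_zero.1 hcoeff).elim (MvPolynomial.mem_support_iff.1 hm)
    (Nat.cast_add_one_ne_zero _)

variable {k B : Type*} [Field k] [CommRing B] [Algebra k B]

theorem aeval_pderiv_mem_of_aeval_mem {n : ℕ} {P : Ideal B} [P.IsPrime]
    {D : Fin n → Derivation k B B} (hD : ∀ j, ∀ a ∈ P, D j a ∈ P) {c : Fin n → B}
    (hdet : (Matrix.of fun j i => D j (c i)).det ∉ P) {p : MvPolynomial (Fin n) k}
    (hp : MvPolynomial.aeval c p ∈ P) (i : Fin n) :
    MvPolynomial.aeval c (MvPolynomial.pderiv i p) ∈ P := by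
  set M : Matrix (Fin n) (Fin n) (B ⧸ P) :=
    (Ideal.Quotient.mk P).mapMatrix (Matrix.of fun j i => D j (c i))
  have hM : M.det ≠ 0 := by
    rwa [← RingHom.map_det, Ne, Ideal.Quotient.eq_zero_iff_mem]
  have hker : M.mulVec (fun i => Ideal.Quotient.mk P
      (MvPolynomial.aeval c (MvPolynomial.pderiv i p))) = 0 := by
    ext j
    have h := Ideal.Quotient.eq_zero_iff_mem.2 (hD j _ hp)
    simp only [derivation_aeval, map_sum, smul_eq_mul, map_mul] at h
    simpa [Matrix.mulVec, dotProduct, M, mul_comm] using h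
  exact Ideal.Quotient.eq_zero_iff_mem.1 (congrFun (Matrix.eq_zero_of_mulVec_eq_zero hM hker) i)

theorem algebraicIndependent_of_det_notMem [CharZero k] {n : ℕ} {P : Ideal B} [P.IsPrime]
    {D : Fin n → Derivation k B B} (hD : ∀ j, ∀ a ∈ P, D j a ∈ P) {c : Fin n → B}
    (hdet : (Matrix.of fun j i => D j (c i)).det ∉ P) :
    AlgebraicIndependent k (fun i => Ideal.Quotient.mk P (c i)) := by
  rw [algebraicIndependent_iff]
  intro p hp
  have hpP : MvPolynomial.aeval c p ∈ P := by
    rw [← Ideal.Quotient.eq_zero_iff_mem, ← hp]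
    exact DFunLike.congr_fun (MvPolynomial.comp_aeval (f := c) (Ideal.Quotient.mkₐ k P)) p
  clear hp
  -- A relation of positive degree has a nonzero partial derivative, a relation of lower degree.
  induction hN : p.totalDegree using Nat.strong_induction_on generalizing p with
  | _ N ih =>
    by_cases hp0 : p.totalDegree = 0
    · rw [MvPolynomial.totalDegree_eq_zero_iff_eq_C] at hp0
      rw [hp0, MvPolynomial.aeval_C] at hpP
      by_contra hne
      have hu : IsUnit (p.coeff 0) := isUnit_iff_ne_zero.2 fun h0 => hne (by rw [hp0, h0, map_zero])
      exact Ideal.IsPrime.ne_top ‹_› (Ideal.eq_top_of_isUnit_mem _ hpP (hu.map _))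
    · obtain ⟨i, hi⟩ := exists_pderiv_ne_zero hp0
      exact absurd (ih _ (hN ▸ totalDegree_pderiv_lt hp0 i) _
        (aeval_pderiv_mem_of_aeval_mem hD hdet hpP i) rfl) hi

theorem pow_mul_derivation_pow_mem [CharZero k] {D : Derivation k B B} {J : Ideal B}
    (hJ : ∀ a ∈ J, D a ∈ J) {a : B} {m i : ℕ} (h : a ^ (m + 1) * D a ^ (2 * i) ∈ J) :
    a ^ m * D a ^ (2 * (i + 1)) ∈ J := by
  have hmul : ((m + 1 : ℕ) : B) * (a ^ m * D a ^ (2 * (i + 1))) ∈ J := by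
    have hD := hJ _ h
    rw [D.leibniz, D.leibniz_pow, D.leibniz_pow] at hD
    simp only [smul_eq_mul, nsmul_eq_mul, Nat.add_sub_cancel] at hD
    convert sub_mem (J.mul_mem_left (D a) hD) (J.mul_mem_left ((2 * i : ℕ) * D (D a)) h) using 1
    rcases i with _ | i
    · simp; ring
    · rw [show 2 * (i + 1) - 1 = 2 * i + 1 by omega]; ring
  have hinv := J.mul_mem_left (algebraMap k B ((m + 1 : ℕ) : k)⁻¹) hmul
  rwa [← mul_assoc, ← map_natCast (algebraMap k B), ← map_mul,
    inv_mul_cancel₀ (Nat.cast_ne_zero.2 m.succ_ne_zero), map_one, one_mul] at hinv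

theorem derivation_mem_radical [CharZero k] {D : Derivation k B B} {J : Ideal B}
    (hJ : ∀ a ∈ J, D a ∈ J) {a : B} (ha : a ∈ J.radical) : D a ∈ J.radical := by
  obtain ⟨n, hn⟩ := ha
  have hpow : ∀ i ≤ n, a ^ (n - i) * D a ^ (2 * i) ∈ J := by
    intro i
    induction i with
    | zero => intro _; simpa using hn
    | succ i ih =>
      intro hi
      apply pow_mul_derivation_pow_mem hJ
      rw [show n - (i + 1) + 1 = n - i by omega]
      exact ih (by omega)
  exact ⟨2 * n, by simpa using hpow n le_rfl⟩

theorem exists_derivation_extending_of_formallyEtale {k S T : Type*} [CommRing k] [CommRing S]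
    [CommRing T] [Algebra k S] [Algebra k T] [Algebra S T] [IsScalarTower k S T]
    [Algebra.FormallyEtale S T] (d : Derivation k S T) :
    ∃ D : Derivation k T T, ∀ s, D (algebraMap S T s) = d s := by
  let e := KaehlerDifferential.tensorKaehlerEquivOfFormallyEtale k S T
  let l : TensorProduct S T (Ω[S⁄k]) →ₗ[T] T :=
    TensorProduct.AlgebraTensorModule.lift
      ((LinearMap.toSpanSingleton T (Ω[S⁄k] →ₗ[S] T) d.liftKaehlerDifferential))
  refine ⟨(l ∘ₗ e.symm.toLinearMap).compDer (KaehlerDifferential.D k T), fun s => ?_⟩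
  change l (e.symm (KaehlerDifferential.D k T (algebraMap S T s))) = _
  rw [KaehlerDifferential.tensorKaehlerEquivOfFormallyEtale_symm_D_algebraMap]
  simp [l]

theorem formallyEtale_of_isAlgebraic {S K : Type*} [CommRing S] [IsDomain S] [Field K] [CharZero K]
    [Algebra S K] [FaithfulSMul S K] [Algebra.IsAlgebraic S K] : Algebra.FormallyEtale S K := by
  let F := FractionRing S
  let _ : Algebra F K := FractionRing.liftAlgebra S K
  have : IsScalarTower S F K := FractionRing.isScalarTower_liftAlgebra S K
  have : Algebra.IsAlgebraic F K := Algebra.IsAlgebraic.extendScalars (R := S)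
    (IsFractionRing.injective S F)
  have : CharZero F := (algebraMap F K).charZero
  have : Algebra.FormallyEtale F K := Algebra.FormallyEtale.of_isSeparable F K
  have : Algebra.FormallyEtale S F := Algebra.FormallyEtale.of_isLocalization (nonZeroDivisors S)
  exact Algebra.FormallyEtale.comp S F K

theorem exists_derivation_of_isTranscendenceBasis [CharZero k] {ι K : Type*} [Field K] [Algebra k K]
    {x : ι → K} (hx : IsTranscendenceBasis k x) (v : ι → K) :
    ∃ D : Derivation k K K, ∀ i, D (x i) = v i := by
  let S := MvPolynomial ι k
  let _ : Algebra S K := (MvPolynomial.aeval x).toRingHom.toAlgebra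
  have : IsScalarTower k S K :=
    IsScalarTower.of_algebraMap_eq fun r => ((MvPolynomial.aeval x).commutes r).symm
  have : CharZero K := charZero_of_injective_algebraMap (algebraMap k K).injective
  have : FaithfulSMul S K := (faithfulSMul_iff_algebraMap_injective _ _).2 hx.1
  have := hx.isAlgebraic
  have : Algebra.IsAlgebraic S K :=
    Algebra.IsAlgebraic.of_ringHom_of_comp_eq (f := hx.1.aevalEquiv) (g := RingHom.id K)
      hx.1.aevalEquiv.surjective Function.injective_id
      (RingHom.ext fun p => hx.1.algebraMap_aevalEquiv p)
  have : Algebra.FormallyEtale S K := formallyEtale_of_isAlgebraic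
  obtain ⟨D, hD⟩ := exists_derivation_extending_of_formallyEtale
    (MvPolynomial.mkDerivation k v : Derivation k S K)
  refine ⟨D, fun i => ?_⟩
  simpa [MvPolynomial.mkDerivation_X, RingHom.algebraMap_toAlgebra] using hD (MvPolynomial.X i)

theorem exists_derivation_of_algebraicIndependent [CharZero k] {ι K : Type*} [Field K]
    [Algebra k K] {c : ι → K} (hc : AlgebraicIndependent k c) (v : ι → K) :
    ∃ D : Derivation k K K, ∀ i, D (c i) = v i := by
  obtain ⟨t, hct, ht⟩ := exists_isTranscendenceBasis_superset hc.to_subtype_range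
  obtain ⟨D, hD⟩ := exists_derivation_of_isTranscendenceBasis ht
    (Function.extend (fun i => (⟨c i, hct ⟨i, rfl⟩⟩ : t)) v 0)
  refine ⟨D, fun i => (hD ⟨c i, hct ⟨i, rfl⟩⟩).trans ?_⟩
  have hinj : Function.Injective fun i => (⟨c i, hct ⟨i, rfl⟩⟩ : t) :=
    fun _ _ hij => hc.injective (congrArg Subtype.val hij)
  exact hinj.extend_apply v 0 i

end Derivations

section PointDerivations

/-- The point derivations of a `k`-algebra `A` at a point `ε`, a homomorphism `A → k`: the linear
forms that satisfy the Leibniz rule at `ε`. They form the Zariski tangent space at `ε`. -/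
def pointDerivations {k A : Type*} [CommRing k] [CommRing A] [Algebra k A] (ε : A →ₐ[k] k) :
    Submodule k (Module.Dual k A) where
  carrier := {X | ∀ f g : A, X (f * g) = ε f * X g + ε g * X f}
  add_mem' {X Y} hX hY f g := by simp only [LinearMap.add_apply, hX f g, hY f g]; ring
  zero_mem' f g := by simp
  smul_mem' r X hX f g := by simp only [LinearMap.smul_apply, hX f g, smul_eq_mul]; ring

section CommRing

variable {k A A' : Type*} [CommRing k] [CommRing A] [Algebra k A] [CommRing A'] [Algebra k A']

theorem apply_algebraMap_of_mem_pointDerivations {ε : A →ₐ[k] k} {X : Module.Dual k A}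
    (hX : X ∈ pointDerivations ε) (r : k) : X (algebraMap k A r) = 0 := by
  have h1 : X 1 = 0 := by simpa using hX 1 1
  rw [Algebra.algebraMap_eq_smul_one, map_smul, h1, smul_zero]

theorem comp_derivation_mem_pointDerivations (ε : A →ₐ[k] k) (D : Derivation k A A) :
    ε.toLinearMap ∘ₗ D.toLinearMap ∈ pointDerivations ε := fun f g => by
  simp [D.leibniz]

theorem comp_mem_pointDerivations (ψ : A →ₐ[k] A') {ε : A' →ₐ[k] k} {X : Module.Dual k A'}
    (hX : X ∈ pointDerivations ε) : X ∘ₗ ψ.toLinearMap ∈ pointDerivations (ε.comp ψ) :=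
  fun f g => by simpa using hX (ψ f) (ψ g)

theorem map_dualMap_pointDerivations {ψ : A →ₐ[k] A'} (hψ : Function.Surjective ψ)
    (ε : A' →ₐ[k] k) :
    (pointDerivations ε).map ψ.toLinearMap.dualMap =
      pointDerivations (ε.comp ψ) ⊓ (LinearMap.ker ψ.toLinearMap).dualAnnihilator := by
  rw [← LinearMap.range_dualMap_eq_dualAnnihilator_ker_of_surjective _ hψ]
  apply le_antisymm
  · rintro _ ⟨Y, hY, rfl⟩
    exact ⟨comp_mem_pointDerivations ψ hY, Y, rfl⟩
  · rintro _ ⟨hX, Y, rfl⟩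
    refine ⟨Y, fun f g => ?_, rfl⟩
    obtain ⟨f, rfl⟩ := hψ f
    obtain ⟨g, rfl⟩ := hψ g
    simpa using hX f g

end CommRing

theorem exists_derivation_eq_mul_of_finiteType {k C K : Type*} [CommRing k] [CommRing C]
    [Algebra k C] [Algebra.FiniteType k C] [CommRing K] [Algebra C K] [IsFractionRing C K]
    [Algebra k K] [IsScalarTower k C K] (D : Derivation k C K) :
    ∃ d ∈ nonZeroDivisors C, ∃ E : Derivation k C C,
      ∀ f, algebraMap C K (E f) = algebraMap C K d * D f := by
  classical
  have hinj := IsFractionRing.injective C K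
  obtain ⟨s, hs⟩ := ‹Algebra.FiniteType k C›.out
  obtain ⟨⟨d, hd⟩, hds⟩ := IsLocalization.exist_integer_multiples_of_finset
    (nonZeroDivisors C) (S := K) (s.image D)
  have hint (f : C) : ∃ q, algebraMap C K q = algebraMap C K d * D f := by
    have hf : f ∈ Algebra.adjoin k (s : Set C) := hs ▸ Algebra.mem_top
    induction hf using Algebra.adjoin_induction with
    | mem f hf =>
      obtain ⟨q, hq⟩ := hds _ (Finset.mem_image_of_mem _ hf)
      exact ⟨q, hq.trans (Algebra.smul_def d (D f))⟩
    | algebraMap r => exact ⟨0, by simp⟩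
    | add f g _ _ hf hg =>
      obtain ⟨p, hp⟩ := hf
      obtain ⟨q, hq⟩ := hg
      exact ⟨p + q, by simp only [map_add, hp, hq, mul_add]⟩
    | mul f g _ _ hf hg =>
      obtain ⟨p, hp⟩ := hf
      obtain ⟨q, hq⟩ := hg
      refine ⟨f * q + g * p, ?_⟩
      simp only [map_add, map_mul, hp, hq, D.leibniz, Algebra.smul_def]
      ring
  choose E hE using hint
  refine ⟨d, hd, Derivation.mk'
    { toFun := E
      map_add' := fun f g => hinj (by simp only [map_add, hE, mul_add])
      map_smul' := fun r f => hinj (by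
        rw [hE, D.map_smul, RingHom.id_apply, mul_smul_comm, ← hE,
          Algebra.smul_def r (E f), map_mul, ← IsScalarTower.algebraMap_apply, Algebra.smul_def]) }
    fun f g => hinj ?_, hE⟩
  simp only [LinearMap.coe_mk, AddHom.coe_mk, smul_eq_mul, map_add, map_mul, hE, D.leibniz,
    Algebra.smul_def]
  ring

theorem exists_algebraicIndependent_quotient_minimalPrimes {k A B : Type*} [Field k] [CommRing A]
    [Algebra k A] [Algebra.FiniteType k A] [CommRing B] [Algebra k B] {ι : A →ₐ[k] B}
    (hι : Function.Injective ι) {s : Set A} (hs : Algebra.adjoin k s = ⊤) {n : ℕ}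
    (hn : n ≤ ringKrullDim A) :
    ∃ P ∈ minimalPrimes B, ∃ a : Fin n → A, (∀ i, a i ∈ s) ∧
      AlgebraicIndependent k (fun i => Ideal.Quotient.mk P (ι (a i))) := by
  obtain ⟨Q, hQ, hnQ⟩ := exists_minimalPrimes_le_ringKrullDim_quotient (I := (⊥ : Ideal A))
    (hn.trans_eq (ringKrullDim_eq_of_ringEquiv (RingEquiv.quotientBot A).symm))
  have hQprime : Q.IsPrime := hQ.1.1
  have hadjoin : Algebra.adjoin k (Ideal.Quotient.mkₐ k Q '' s) = ⊤ := by
    rw [← AlgHom.map_adjoin, hs, Algebra.map_top, AlgHom.range_eq_top]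
    exact Ideal.Quotient.mkₐ_surjective k Q
  obtain ⟨c, hcs, hc⟩ := exists_algebraicIndependent_of_natCast_le_ringKrullDim hnQ hadjoin
  choose a has hac using hcs
  obtain rfl : (fun i => Ideal.Quotient.mkₐ k Q (a i)) = c := funext hac
  obtain ⟨P, hP, hPQ⟩ := Ideal.exists_minimalPrimes_comap_eq (I := ⊥) ι.toRingHom Q
    (by rwa [← RingHom.ker_eq_comap_bot, (RingHom.injective_iff_ker_eq_bot ι.toRingHom).1 hι])
  let ψ : A ⧸ Q →ₐ[k] B ⧸ P := Ideal.quotientMapₐ P ι hPQ.ge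
  have hψ : Function.Injective ψ := Ideal.quotientMap_injective' (H := hPQ.ge) hPQ.le
  refine ⟨P, hP, a, has, ?_⟩
  have hψmk (i : Fin n) : ψ (Ideal.Quotient.mk Q (a i)) = Ideal.Quotient.mk P (ι (a i)) :=
    Ideal.quotientMap_mk (H := hPQ.ge)
  simpa only [Function.comp_def, Ideal.Quotient.mkₐ_eq_mk, hψmk] using hc.map' hψ

variable {k : Type*} [Field k] [CharZero k]

theorem exists_dual_derivations {C ι : Type*} [CommRing C] [IsDomain C] [Algebra k C]
    [Algebra.FiniteType k C] [DecidableEq ι] {c : ι → C} (hc : AlgebraicIndependent k c) :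
    ∃ (d : ι → C) (E : ι → Derivation k C C),
      (∀ i, d i ≠ 0) ∧ ∀ i j, E i (c j) = if i = j then d i else 0 := by
  have hE (i : ι) : ∃ d ≠ 0, ∃ E : Derivation k C C, ∀ j, E (c j) = if i = j then d else 0 := by
    have hinj := IsFractionRing.injective C (FractionRing C)
    obtain ⟨D, hD⟩ := exists_derivation_of_algebraicIndependent
      ((AlgHom.algebraicIndependent_iff (IsScalarTower.toAlgHom k C (FractionRing C)) hinj).2 hc)
      (fun j => if i = j then 1 else 0)
    obtain ⟨d, hd, E, hE⟩ := exists_derivation_eq_mul_of_finiteType (D.compAlgebraMap C)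
    refine ⟨d, nonZeroDivisors.ne_zero hd, E, fun j => hinj ?_⟩
    have hDj : D.compAlgebraMap C (c j) = if i = j then 1 else 0 := hD j
    rw [hE, hDj, mul_ite, mul_one, mul_zero, apply_ite (algebraMap C _), map_zero]
  choose d hd E hE using hE
  exact ⟨d, E, hd, hE⟩

theorem exists_pointDerivations_det_ne_zero {A X : Type*} [CommRing A] [IsReduced A] [Algebra k A]
    [Algebra.FiniteType k A] {ev : X → A →ₐ[k] k} (hev : ∀ f, (∀ x, ev x f = 0) → f = 0)
    {P : Ideal A} (hP : P ∈ minimalPrimes A) {n : ℕ} {c : Fin n → A}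
    (hc : AlgebraicIndependent k (fun i => Ideal.Quotient.mk P (c i))) :
    ∃ (x : X) (δ : Fin n → Module.Dual k A), (∀ i, δ i ∈ pointDerivations (ev x)) ∧
      (Matrix.of fun i j => δ i (c j)).det ≠ 0 := by
  have hPprime : P.IsPrime := hP.1.1
  have := Algebra.FiniteType.isNoetherianRing k A
  obtain ⟨t, htP, ht⟩ := exists_notMem_forall_mul_eq_zero_of_mem_minimalPrimes hP
  obtain ⟨d, E, hd, hE⟩ := exists_dual_derivations hc
  choose e he using fun i => Ideal.Quotient.mk_surjective (d i)
  have hne : t * ∏ i, e i ∉ P := by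
    simp only [hPprime.mul_mem_iff_mem_or_mem, hPprime.prod_mem_iff,
      ← Ideal.Quotient.eq_zero_iff_mem, he]
    simpa [Ideal.Quotient.eq_zero_iff_mem, htP] using hd
  obtain ⟨x, hx⟩ : ∃ x, ev x (t * ∏ i, e i) ≠ 0 := by
    by_contra! h
    exact hne (hev _ h ▸ zero_mem P)
  rw [map_mul, map_prod] at hx
  have hxP : ∀ p ∈ P, ev x p = 0 := fun p hp =>
    (mul_eq_zero.1 (by rw [← map_mul, ht p hp, map_zero])).resolve_left (left_ne_zero_of_mul hx)
  let ε : (A ⧸ P) →ₐ[k] k := Ideal.Quotient.liftₐ P (ev x) hxP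
  refine ⟨x, fun i => (ε.toLinearMap ∘ₗ (E i).toLinearMap) ∘ₗ (Ideal.Quotient.mkₐ k P).toLinearMap,
    fun i => comp_mem_pointDerivations (Ideal.Quotient.mkₐ k P)
      (comp_derivation_mem_pointDerivations ε (E i)), ?_⟩
  have hdiag : (Matrix.of fun i j => ε (E i (Ideal.Quotient.mk P (c j)))) =
      Matrix.diagonal fun i => ev x (e i) := by
    ext i j
    rw [Matrix.of_apply, hE, ← he, apply_ite ε, map_zero, Matrix.diagonal_apply]
    rfl
  change (Matrix.of fun i j => ε (E i (Ideal.Quotient.mk P (c j)))).det ≠ 0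
  rw [hdiag, Matrix.det_diagonal]
  exact right_ne_zero_of_mul hx

variable {A B : Type*} [CommRing A] [Algebra k A] [Algebra.FiniteType k A]
  [CommRing B] [IsReduced B] [Algebra k B] [Algebra.FiniteType k B]

theorem natCast_le_ringKrullDim_of_det_ne_zero (ι : A →ₐ[k] B) (ε : B →ₐ[k] k) {n : ℕ}
    {D : Fin n → Derivation k B B} {c : Fin n → A}
    (hdet : (Matrix.of fun j i => ε (D j (ι (c i)))).det ≠ 0) : n ≤ ringKrullDim A := by
  have := Algebra.FiniteType.isNoetherianRing k B
  have hker : (RingHom.ker ε).IsPrime := RingHom.ker_isPrime _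
  obtain ⟨P, hP, hPle⟩ := Ideal.exists_minimalPrimes_le (I := ⊥) (J := RingHom.ker ε) bot_le
  have hPprime : P.IsPrime := hP.1.1
  have hc : AlgebraicIndependent k (fun i => Ideal.Quotient.mk P (ι (c i))) := by
    refine algebraicIndependent_of_det_notMem
      (fun j a ha => derivation_mem_of_mem_minimalPrimes (D j) hP ha) fun hmem => hdet ?_
    have hε : ε _ = 0 := hPle hmem
    rwa [AlgHom.map_det] at hε
  let ψ : A →ₐ[k] B ⧸ P := (Ideal.Quotient.mkₐ k P).comp ι
  have : Algebra.FiniteType k ψ.range :=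
    Algebra.FiniteType.of_surjective ψ.rangeRestrict ψ.rangeRestrict_surjective
  have hcψ : AlgebraicIndependent k (fun i => ψ.rangeRestrict (c i)) :=
    (AlgHom.algebraicIndependent_iff ψ.range.val Subtype.val_injective).1 hc
  exact (natCast_le_ringKrullDim_of_algebraicIndependent hcψ).trans
    (ringKrullDim_le_of_surjective ψ.rangeRestrict.toRingHom ψ.rangeRestrict_surjective)

end PointDerivations

section LinearAlgebra

variable {k E V V' : Type*} [Field k] [AddCommGroup E] [Module k E]
  [AddCommGroup V] [Module k V] [AddCommGroup V'] [Module k V']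

theorem finrank_map_prod [FiniteDimensional k V] [FiniteDimensional k V'] (p : Submodule k E)
    (L : E →ₗ[k] V) (M : E →ₗ[k] V') :
    Module.finrank k (p.map (L.prod M)) =
      Module.finrank k (p.map L) + Module.finrank k ((p ⊓ LinearMap.ker L).map M) := by
  let f : p.map (L.prod M) →ₗ[k] V := (LinearMap.fst k V V').domRestrict _
  have hrange : LinearMap.range f = p.map L := by
    rw [LinearMap.range_domRestrict, ← Submodule.map_comp, LinearMap.fst_prod]
  have hker : (LinearMap.ker f).map (p.map (L.prod M)).subtype =
      ((p ⊓ LinearMap.ker L).map M).map (LinearMap.inr k V V') := by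
    ext ⟨a, b⟩
    simp only [LinearMap.ker_domRestrict, f, Submodule.mem_map, Submodule.mem_inf]
    aesop
  rw [← f.finrank_range_add_finrank_ker, hrange, ← Submodule.finrank_map_subtype_eq _ f.ker,
    hker,
    ← (Submodule.equivMapOfInjective (LinearMap.inr k V V') LinearMap.inr_injective _).finrank_eq]

theorem finrank_map_eq_of_inf_ker_eq (p : Submodule k E) {L : E →ₗ[k] V} {M : E →ₗ[k] V'}
    (h : p ⊓ LinearMap.ker L = p ⊓ LinearMap.ker M) :
    Module.finrank k (p.map L) = Module.finrank k (p.map M) := by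
  have hker : LinearMap.ker (L.domRestrict p) = LinearMap.ker (M.domRestrict p) := by
    ext ⟨x, hx⟩
    simpa [hx] using SetLike.ext_iff.1 h x
  rw [← LinearMap.range_domRestrict, ← LinearMap.range_domRestrict,
    ← (L.domRestrict p).quotKerEquivRange.finrank_eq,
    ← (M.domRestrict p).quotKerEquivRange.finrank_eq,
    (Submodule.quotEquivOfEq _ _ hker).finrank_eq]

theorem le_finrank_iff_exists_det_ne_zero [FiniteDimensional k V] {W : Submodule k V} {n : ℕ} :
    n ≤ Module.finrank k W ↔ ∃ (w : Fin n → V) (φ : Fin n → Module.Dual k V),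
      (∀ i, w i ∈ W) ∧ (Matrix.of fun i j => φ i (w j)).det ≠ 0 := by
  constructor
  · intro hn
    let b := Module.finBasis k W
    have hφ (i : Fin n) : ∃ φ : Module.Dual k V, φ ∘ₗ W.subtype = b.coord (Fin.castLE hn i) :=
      LinearMap.exists_extend _
    choose φ hφ using hφ
    refine ⟨fun j => b (Fin.castLE hn j), φ, fun j => (b _).2, ?_⟩
    have hone : (Matrix.of fun i j => φ i (b (Fin.castLE hn j))) = 1 := by
      ext i j
      rw [Matrix.of_apply, ← Submodule.subtype_apply, ← LinearMap.comp_apply, hφ, b.coord_apply,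
        b.repr_self, Finsupp.single_apply, Matrix.one_apply]
      simp only [Fin.castLE_inj, eq_comm]
    rw [hone, Matrix.det_one]
    exact one_ne_zero
  · rintro ⟨w, φ, hw, hdet⟩
    have hind : LinearIndependent k fun j => (⟨w j, hw j⟩ : W) := by
      rw [Fintype.linearIndependent_iff]
      intro a ha
      refine congrFun (Matrix.eq_zero_of_mulVec_eq_zero hdet (funext fun i => ?_))
      simpa [Matrix.mulVec, dotProduct, mul_comm] using congrArg (fun u : W => φ i u) ha
    simpa using hind.fintype_card_le_finrank

end LinearAlgebra

section TangentSpace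

variable {k H : Type*} [Field k]

/-- Evaluation at the point `x`, on an algebra `B` of functions. -/
def evaluation (B : Subalgebra k (H → k)) (x : H) : B →ₐ[k] k :=
  (Pi.evalAlgHom k (fun _ => k) x).comp B.val

theorem evaluation_apply {B : Subalgebra k (H → k)} (x : H) (f : B) :
    evaluation B x f = (f : H → k) x := rfl

variable [Group H]

/-- The tangent space at `1` of a group with algebra of regular functions `B`. -/
def tangentSpace (B : Subalgebra k (H → k)) : Submodule k (Module.Dual k B) :=
  pointDerivations (evaluation B 1)

/-- The multiplication of `H` pulls back functions in `B` to functions in `B ⊗ B`. -/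
def HasComul (B : Subalgebra k (H → k)) : Prop :=
  ∀ f ∈ B, ∃ (n : ℕ) (a b : Fin n → B),
    ∀ x y : H, f (x * y) = ∑ i, (a i : H → k) x * (b i : H → k) y

variable {B : Subalgebra k (H → k)}

namespace HasComul

theorem translate_mem (hB : HasComul B) (x : H) {f : H → k} (hf : f ∈ B) :
    (fun y => f (x * y)) ∈ B := by
  obtain ⟨n, a, b, hab⟩ := hB f hf
  have hsum : (fun y => f (x * y)) = ∑ i, (a i : H → k) x • (b i : H → k) := by
    ext y
    simp [hab]
  exact hsum ▸ sum_mem fun i _ => B.smul_mem (b i).2 _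

/-- Left translation of functions: `(hB.translate x f) y = f (x * y)`. -/
def translate (hB : HasComul B) (x : H) : B →ₐ[k] B :=
  AlgHom.codRestrict ((AlgHom.pi fun y => Pi.evalAlgHom k (fun _ => k) (x * y)).comp B.val) B
    fun f => hB.translate_mem x f.2

theorem translate_apply (hB : HasComul B) (x y : H) (f : B) :
    (hB.translate x f : H → k) y = (f : H → k) (x * y) := rfl

theorem translate_one (hB : HasComul B) (f : B) : hB.translate 1 f = f := by
  ext y
  rw [hB.translate_apply, one_mul]

theorem comp_translate_inv_mem_tangentSpace (hB : HasComul B) {x : H} {δ : Module.Dual k B}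
    (hδ : δ ∈ pointDerivations (evaluation B x)) :
    δ ∘ₗ (hB.translate x⁻¹).toLinearMap ∈ tangentSpace B := by
  rw [tangentSpace, ← inv_mul_cancel x]
  exact comp_mem_pointDerivations (hB.translate x⁻¹) hδ

theorem apply_translate_mem (hB : HasComul B) (X : Module.Dual k B) (f : B) :
    (fun x => X (hB.translate x f)) ∈ B := by
  obtain ⟨n, a, b, hab⟩ := hB f f.2
  have htranslate (x : H) : hB.translate x f = ∑ i, (a i : H → k) x • b i := by
    ext y
    simp [hB.translate_apply, hab]
  have hsum : (fun x => X (hB.translate x f)) = ∑ i, X (b i) • (a i : H → k) := by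
    ext x
    simp [htranslate, mul_comm]
  exact hsum ▸ sum_mem fun i _ => B.smul_mem (a i).2 _

/-- The left invariant derivation whose value at `1` is the tangent vector `X`. -/
def invariantDerivation (hB : HasComul B) (X : tangentSpace B) : Derivation k B B :=
  Derivation.mk'
    { toFun := fun f => ⟨fun x => X.1 (hB.translate x f), hB.apply_translate_mem X.1 f⟩
      map_add' := fun f g => by ext x; simp
      map_smul' := fun r f => by ext x; simp }
    fun f g => by
      ext x
      simpa [evaluation_apply, hB.translate_apply] using X.2 (hB.translate x f) (hB.translate x g)

theorem invariantDerivation_apply (hB : HasComul B) (X : tangentSpace B) (f : B) (x : H) :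
    (hB.invariantDerivation X f : H → k) x = X.1 (hB.translate x f) := rfl

theorem evaluation_one_invariantDerivation (hB : HasComul B) (X : tangentSpace B) (f : B) :
    evaluation B 1 (hB.invariantDerivation X f) = X.1 f := by
  rw [evaluation_apply, hB.invariantDerivation_apply, hB.translate_one]

end HasComul

variable (S : Subgroup H)

variable (k) in
/-- Restriction of functions from `H` to a subgroup. -/
def restrictFunctions : (H → k) →ₐ[k] (S → k) :=
  AlgHom.pi fun s : S => Pi.evalAlgHom k (fun _ => k) (s : H)

variable (B) in
/-- Restriction to a subgroup, as a homomorphism from `B` onto its image: a subgroup is given the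
restrictions of the functions in `B` as its algebra of regular functions. -/
def restrictSubalgebra : B →ₐ[k] B.map (restrictFunctions k S) :=
  AlgHom.codRestrict ((restrictFunctions k S).comp B.val) _ fun f => ⟨f, f.2, rfl⟩

theorem restrictSubalgebra_surjective : Function.Surjective (restrictSubalgebra B S) := by
  rintro ⟨_, f, hf, rfl⟩
  exact ⟨⟨f, hf⟩, rfl⟩

theorem HasComul.restrict (hB : HasComul B) : HasComul (B.map (restrictFunctions k S)) := by
  rintro _ ⟨f, hf, rfl⟩
  obtain ⟨n, a, b, hab⟩ := hB f hf
  exact ⟨n, fun i => restrictSubalgebra B S (a i), fun i => restrictSubalgebra B S (b i),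
    fun x y => hab x y⟩

theorem map_dualMap_tangentSpace_restrict :
    (tangentSpace (B.map (restrictFunctions k S))).map
        (restrictSubalgebra B S).toLinearMap.dualMap =
      tangentSpace B ⊓
        (LinearMap.ker (restrictSubalgebra B S).toLinearMap).dualAnnihilator :=
  map_dualMap_pointDerivations (restrictSubalgebra_surjective S) _

end TangentSpace

section RestrictedRegularFunctions

variable {k V : Type*} [Field k] [AddCommGroup V] [Module k V]

theorem restrictedRegularFunctions_fg [FiniteDimensional k V] (X : Set V) :
    (restrictedRegularFunctions k X).FG := by
  have hfg : (regularFunctions k V).FG := by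
    rw [← range_polynomialFunction, ← Algebra.map_top]
    exact Algebra.FiniteType.out.map _
  exact hfg.map _

/-- The restriction to `X` of a linear form, as a regular function on `X`. -/
def restrictDual (X : Set V) (φ : Module.Dual k V) : restrictedRegularFunctions k X :=
  ⟨fun x => φ x, φ, dual_mem_regularFunctions φ, rfl⟩

theorem adjoin_range_restrictDual (X : Set V) :
    Algebra.adjoin k (Set.range (restrictDual (k := k) X)) = ⊤ := by
  apply Subalgebra.map_injective (f := (restrictedRegularFunctions k X).val)
    Subtype.val_injective
  rw [AlgHom.map_adjoin, Algebra.map_top, Subalgebra.range_val, ← Set.range_comp]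
  refine Eq.trans ?_ (AlgHom.map_adjoin _ _).symm
  rw [← Set.range_comp]
  rfl

end RestrictedRegularFunctions

section Orbits

variable {k H V : Type*} [Field k] [Group H] [AddCommGroup V] [Module k V]
  [DistribMulAction H V]

/-- The matrix coefficients of the action of `H` on `V` are in `B`: the action is rational if `B`
is the algebra of regular functions on `H`. -/
def HasCoefficientsIn (B : Subalgebra k (H → k)) (V : Type*) [AddCommGroup V] [Module k V]
    [DistribMulAction H V] : Prop :=
  ∀ (φ : Module.Dual k V) (v : V), (fun g : H => φ (g • v)) ∈ B

namespace HasCoefficientsIn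

variable {B : Subalgebra k (H → k)}

/-- The matrix coefficients `g ↦ φ (g • v)` at a vector `v`. -/
def coeff (hV : HasCoefficientsIn B V) (v : V) : Module.Dual k V →ₗ[k] B where
  toFun φ := ⟨fun g => φ (g • v), hV φ v⟩
  map_add' _ _ := rfl
  map_smul' _ _ := rfl

theorem coeff_apply (hV : HasCoefficientsIn B V) (v : V) (φ : Module.Dual k V) (g : H) :
    (hV.coeff v φ : H → k) g = φ (g • v) := rfl

theorem translate_coeff [SMulCommClass H k V] (hV : HasCoefficientsIn B V) (hB : HasComul B)
    (g : H) (v : V) (φ : Module.Dual k V) :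
    hB.translate g (hV.coeff v φ) = hV.coeff v (φ ∘ₗ DistribSMul.toLinearMap k V g) := by
  ext x
  simp [hB.translate_apply, coeff_apply, mul_smul]

theorem pullback_mem (hV : HasCoefficientsIn B V) (v : V) {f : V → k}
    (hf : f ∈ regularFunctions k V) : (fun g : H => f (g • v)) ∈ B := by
  induction hf using Algebra.adjoin_induction with
  | mem x hx =>
    obtain ⟨φ, rfl⟩ := hx
    exact hV φ v
  | algebraMap r => exact B.algebraMap_mem r
  | add x y _ _ hx hy => exact add_mem hx hy
  | mul x y _ _ hx hy => exact mul_mem hx hy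

/-- The comorphism of the map `g ↦ g • v` from `H` to the orbit of `v`. -/
def pullback (hV : HasCoefficientsIn B V) (v : V) :
    restrictedRegularFunctions k (MulAction.orbit H v) →ₐ[k] B :=
  AlgHom.codRestrict ((AlgHom.pi fun g => Pi.evalAlgHom k (fun _ => k) ⟨g • v, g, rfl⟩).comp
    (restrictedRegularFunctions k (MulAction.orbit H v)).val) B <| by
      rintro ⟨_, f, hf, rfl⟩
      exact hV.pullback_mem v hf

theorem pullback_restrictDual (hV : HasCoefficientsIn B V) (v : V) (φ : Module.Dual k V) :
    hV.pullback v (restrictDual _ φ) = hV.coeff v φ := rfl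

theorem pullback_injective (hV : HasCoefficientsIn B V) (v : V) :
    Function.Injective (hV.pullback v) := by
  intro f f' h
  ext ⟨_, g, rfl⟩
  exact congrFun (congrArg Subtype.val h) g

theorem restrict (hV : HasCoefficientsIn B V) (S : Subgroup H) :
    HasCoefficientsIn (H := S) (B.map (restrictFunctions k S)) V :=
  fun φ v => ⟨_, hV φ v, rfl⟩

variable [FiniteDimensional k V]

/-- The differential at `1` of the orbit map `g ↦ g • v`, on all linear forms on `B`. -/
noncomputable def orbitMap (hV : HasCoefficientsIn B V) (v : V) : Module.Dual k B →ₗ[k] V :=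
  (Module.evalEquiv k V).symm.toLinearMap ∘ₗ (hV.coeff v).dualMap

theorem dual_orbitMap (hV : HasCoefficientsIn B V) (v : V)
    (X : Module.Dual k B) (φ : Module.Dual k V) : φ (hV.orbitMap v X) = X (hV.coeff v φ) :=
  Module.apply_evalEquiv_symm_apply _ _ φ ((hV.coeff v).dualMap X)

theorem orbitMap_eq_iff (hV : HasCoefficientsIn B V) {v w : V} {X : Module.Dual k B} :
    hV.orbitMap v X = w ↔ ∀ φ : Module.Dual k V, X (hV.coeff v φ) = φ w := by
  rw [← sub_eq_zero, ← Module.forall_dual_apply_eq_zero_iff k]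
  simp only [map_sub, hV.dual_orbitMap, sub_eq_zero]

theorem orbitMap_restrict (hV : HasCoefficientsIn B V) (S : Subgroup H) (v : V) :
    (hV.restrict S).orbitMap v =
      hV.orbitMap v ∘ₗ (restrictSubalgebra B S).toLinearMap.dualMap := by
  ext X
  exact (orbitMap_eq_iff _).2 fun φ =>
    (hV.dual_orbitMap v (X ∘ₗ (restrictSubalgebra B S).toLinearMap) φ).symm

/-- The action on `V` of a linear form `X` on `B`; for a tangent vector `X`, this is the action of
the Lie algebra. -/
noncomputable def infinitesimalAction [SMulCommClass H k V] (hV : HasCoefficientsIn B V)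
    (X : Module.Dual k B) : V →ₗ[k] V where
  toFun w := hV.orbitMap w X
  map_add' v w := hV.orbitMap_eq_iff.2 fun φ => by
    rw [map_add, dual_orbitMap, dual_orbitMap, ← map_add]
    congr 1
    ext g
    simp [coeff_apply]
  map_smul' r v := hV.orbitMap_eq_iff.2 fun φ => by
    rw [RingHom.id_apply, map_smul, dual_orbitMap, ← map_smul]
    congr 1
    ext g
    simp [coeff_apply, smul_comm g r v]

/-- The tangent space `𝔥 • v` to the orbit at `v`, where `𝔥` is the Lie algebra of `H`. -/
noncomputable def orbitTangent (hV : HasCoefficientsIn B V) (v : V) : Submodule k V :=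
  (tangentSpace B).map (hV.orbitMap v)

theorem orbitTangent_restrict (hV : HasCoefficientsIn B V) (S : Subgroup H) (v : V) :
    (hV.restrict S).orbitTangent v =
      ((tangentSpace (B.map (restrictFunctions k S))).map
        (restrictSubalgebra B S).toLinearMap.dualMap).map (hV.orbitMap v) := by
  rw [orbitTangent, orbitMap_restrict, Submodule.map_comp]

section Dimension

variable [CharZero k]

theorem finrank_orbitTangent_le_zariskiDim (hV : HasCoefficientsIn B V) (hfg : B.FG)
    (hB : HasComul B) (v : V) : (Module.finrank k (hV.orbitTangent v) : WithBot ℕ∞) ≤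
      zariskiDim k (MulAction.orbit H v) := by
  have : Algebra.FiniteType k B := (Subalgebra.fg_iff_finiteType B).1 hfg
  have : Algebra.FiniteType k (restrictedRegularFunctions k (MulAction.orbit H v)) :=
    (Subalgebra.fg_iff_finiteType _).1 (restrictedRegularFunctions_fg _)
  have : IsReduced B := isReduced_of_injective B.val Subtype.val_injective
  obtain ⟨w, φ, hw, hdet⟩ := le_finrank_iff_exists_det_ne_zero.1
    (le_refl (Module.finrank k (hV.orbitTangent v)))
  choose X hX hXw using hw
  refine natCast_le_ringKrullDim_of_det_ne_zero (hV.pullback v) (evaluation B 1)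
    (D := fun j => hB.invariantDerivation ⟨X j, hX j⟩) (c := fun i => restrictDual _ (φ i)) ?_
  rw [← Matrix.det_transpose]
  convert hdet using 3
  ext i j
  rw [Matrix.transpose_apply, Matrix.of_apply, Matrix.of_apply, pullback_restrictDual,
    hB.evaluation_one_invariantDerivation, ← hXw, dual_orbitMap]

theorem le_finrank_orbitTangent [SMulCommClass H k V] (hV : HasCoefficientsIn B V) (hfg : B.FG)
    (hB : HasComul B) (v : V) {n : ℕ} (hn : n ≤ zariskiDim k (MulAction.orbit H v)) :
    n ≤ Module.finrank k (hV.orbitTangent v) := by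
  have : Algebra.FiniteType k B := (Subalgebra.fg_iff_finiteType B).1 hfg
  have : Algebra.FiniteType k (restrictedRegularFunctions k (MulAction.orbit H v)) :=
    (Subalgebra.fg_iff_finiteType _).1 (restrictedRegularFunctions_fg _)
  have : IsReduced B := isReduced_of_injective B.val Subtype.val_injective
  obtain ⟨P, hP, a, ha, hind⟩ := exists_algebraicIndependent_quotient_minimalPrimes
    (hV.pullback_injective v) (adjoin_range_restrictDual _) hn
  choose φ hφ using ha
  obtain rfl : (fun i => restrictDual _ (φ i)) = a := funext hφ
  obtain ⟨h, δ, hδ, hdet⟩ := exists_pointDerivations_det_ne_zero (ev := evaluation B)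
    (fun f hf => Subtype.ext (funext hf)) hP hind
  -- Left translation moves the tangent vectors `δ i` at `h` to tangent vectors at `1`.
  refine le_finrank_iff_exists_det_ne_zero.2
    ⟨fun i => hV.orbitMap v (δ i ∘ₗ (hB.translate h⁻¹).toLinearMap),
      fun j => φ j ∘ₗ DistribSMul.toLinearMap k V h,
      fun i => ⟨_, hB.comp_translate_inv_mem_tangentSpace (hδ i), rfl⟩, ?_⟩
  rw [← Matrix.det_transpose]
  convert hdet using 3
  ext i j
  rw [Matrix.transpose_apply, Matrix.of_apply, Matrix.of_apply, pullback_restrictDual,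
    dual_orbitMap]
  refine congrArg (δ i) (?_ : hB.translate h⁻¹ (hV.coeff v _) = _)
  ext y
  simp [hB.translate_apply, coeff_apply, mul_smul]

theorem zariskiDim_orbit [SMulCommClass H k V] (hV : HasCoefficientsIn B V) (hfg : B.FG)
    (hB : HasComul B) (v : V) :
    zariskiDim k (MulAction.orbit H v) = (Module.finrank k (hV.orbitTangent v) : WithBot ℕ∞) := by
  refine le_antisymm ?_ (hV.finrank_orbitTangent_le_zariskiDim hfg hB v)
  simpa using add_natCast_le_of_forall_natCast_le 0 fun n hn =>
    Nat.cast_le.2 (hV.le_finrank_orbitTangent hfg hB v hn)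

theorem finrank_orbitTangent_smul [SMulCommClass H k V] (hV : HasCoefficientsIn B V)
    (hfg : B.FG) (hB : HasComul B) (g : H) (v : V) :
    Module.finrank k (hV.orbitTangent (g • v)) = Module.finrank k (hV.orbitTangent v) := by
  have h := hV.zariskiDim_orbit hfg hB (g • v)
  rw [MulAction.orbit_smul, hV.zariskiDim_orbit hfg hB] at h
  exact_mod_cast h.symm

theorem mem_regularElements_iff [SMulCommClass H k V] (hV : HasCoefficientsIn B V)
    (hfg : B.FG) (hB : HasComul B) {v : V} :
    v ∈ regularElements k H V ↔ ∀ w, Module.finrank k (hV.orbitTangent w) ≤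
      Module.finrank k (hV.orbitTangent v) := by
  simp only [regularElements, Set.mem_ofPred_eq, hV.zariskiDim_orbit hfg hB, Nat.cast_le]

end Dimension

theorem isZariskiOpen_le_finrank_orbitTangent [SMulCommClass H k V] (hV : HasCoefficientsIn B V)
    (n : ℕ) : IsZariskiOpen k {v : V | n ≤ Module.finrank k (hV.orbitTangent v)} := by
  rw [isZariskiOpen_iff_forall_exists]
  intro v hv
  obtain ⟨w, φ, hw, hdet⟩ := le_finrank_iff_exists_det_ne_zero.1 hv
  choose X hX hXw using hw
  let M : Matrix (Fin n) (Fin n) (regularFunctions k V) :=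
    Matrix.of fun i j => ⟨φ i ∘ₗ hV.infinitesimalAction (X j), dual_mem_regularFunctions _⟩
  have hM (u : V) : (M.det : V → k) u = (Matrix.of fun i j => φ i (hV.orbitMap u (X j))).det := by
    rw [← evaluation_apply, AlgHom.map_det]
    rfl
  refine ⟨M.det, M.det.2, ?_, fun u hu => ?_⟩
  · simpa only [hM, hXw] using hdet
  · exact le_finrank_iff_exists_det_ne_zero.2
      ⟨_, φ, fun j => ⟨X j, hX j, rfl⟩, by simpa only [hM] using hu⟩

theorem exists_forall_finrank_orbitTangent_le (hV : HasCoefficientsIn B V) :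
    ∃ v : V, ∀ w : V, Module.finrank k (hV.orbitTangent w) ≤
      Module.finrank k (hV.orbitTangent v) := by
  have hbdd : BddAbove (Set.range fun v : V => Module.finrank k (hV.orbitTangent v)) :=
    ⟨Module.finrank k V, by rintro _ ⟨v, rfl⟩; exact Submodule.finrank_le _⟩
  obtain ⟨v, hv⟩ := Nat.sSup_mem (Set.range_nonempty _) hbdd
  exact ⟨v, fun w => (le_csSup hbdd ⟨w, rfl⟩).trans hv.ge⟩

theorem regularElements_nonempty [CharZero k] [SMulCommClass H k V] (hV : HasCoefficientsIn B V)
    (hfg : B.FG) (hB : HasComul B) : (regularElements k H V).Nonempty := by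
  obtain ⟨v, hv⟩ := hV.exists_forall_finrank_orbitTangent_le
  exact ⟨v, (hV.mem_regularElements_iff hfg hB).2 hv⟩

theorem isZariskiOpen_regularElements [CharZero k] [SMulCommClass H k V]
    (hV : HasCoefficientsIn B V) (hfg : B.FG) (hB : HasComul B) :
    IsZariskiOpen k (regularElements k H V) := by
  obtain ⟨v, hv⟩ := hV.exists_forall_finrank_orbitTangent_le
  convert hV.isZariskiOpen_le_finrank_orbitTangent (Module.finrank k (hV.orbitTangent v)) using 1
  ext w
  rw [hV.mem_regularElements_iff hfg hB]
  exact ⟨fun h => h v, fun h u => (hv u).trans h⟩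

end HasCoefficientsIn

end Orbits

theorem mem_radical_of_forall_algHom_eq_zero {k A : Type*} [Field k] [IsAlgClosed k]
    [CommRing A] [Algebra k A] [Algebra.FiniteType k A] {J : Ideal A} {f : A}
    (hf : ∀ χ : A →ₐ[k] k, J ≤ RingHom.ker χ → χ f = 0) : f ∈ J.radical := by
  have : IsJacobsonRing A := isJacobsonRing_of_finiteType (A := k)
  rw [Ideal.radical_eq_jacobson, Ideal.jacobson, Ideal.mem_sInf]
  rintro M ⟨hJM, hM⟩
  let _ : Field (A ⧸ M) := Ideal.Quotient.field M
  have : Module.Finite k (A ⧸ M) := finite_of_finite_type_of_isJacobsonRing k (A ⧸ M)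
  let e : k ≃ₐ[k] A ⧸ M := AlgEquiv.ofBijective (Algebra.ofId k (A ⧸ M))
    IsAlgClosed.algebraMap_bijective_of_isIntegral
  have hker (p : A) : e.symm (Ideal.Quotient.mkₐ k M p) = 0 ↔ p ∈ M := by
    rw [EmbeddingLike.map_eq_zero_iff, Ideal.Quotient.mkₐ_eq_mk, Ideal.Quotient.eq_zero_iff_mem]
  exact (hker f).1 (hf (e.symm.toAlgHom.comp (Ideal.Quotient.mkₐ k M))
    fun p hp => (hker p).2 (hJM hp))

namespace AffineAlgebraicGroup

variable {k G : Type*} [Field k] [Group G] [AffineAlgebraicGroup k G]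

theorem hasComul : HasComul (coordRing (k := k) (G := G)) := mul_regular

theorem mem_radical [IsAlgClosed k] {J : Ideal (coordRing (k := k) (G := G))}
    {f : coordRing (k := k) (G := G)}
    (hf : ∀ g : G, J ≤ RingHom.ker (evaluation coordRing g) → evaluation coordRing g f = 0) :
    f ∈ J.radical := by
  have : Algebra.FiniteType k (coordRing (k := k) (G := G)) :=
    (Subalgebra.fg_iff_finiteType _).1 fg
  refine mem_radical_of_forall_algHom_eq_zero (k := k) fun χ hχ => ?_
  obtain ⟨g, rfl⟩ := eval_bijective.2 χ
  exact hf g hχ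

end AffineAlgebraicGroup

section Stabilizers

variable {k G V : Type*} [Field k] [Group G] [AddCommGroup V] [Module k V] [DistribMulAction G V]

namespace HasCoefficientsIn

section Isotropy

variable {B : Subalgebra k (G → k)}

/-- The ideal of functions on `G` generated by the equations `φ (g • v) = φ v` of the stabilizer
of `v`. -/
def isotropyIdeal (hV : HasCoefficientsIn B V) (v : V) : Ideal B :=
  Ideal.span (Set.range fun φ : Module.Dual k V => hV.coeff v φ - algebraMap k B (φ v))

theorem isotropyIdeal_le_ker_evaluation_iff (hV : HasCoefficientsIn B V) (v : V) (g : G) :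
    hV.isotropyIdeal v ≤ RingHom.ker (evaluation B g) ↔ g ∈ MulAction.stabilizer G v := by
  rw [isotropyIdeal, Ideal.span_le, Set.range_subset_iff, MulAction.mem_stabilizer_iff,
    ← sub_eq_zero, ← Module.forall_dual_apply_eq_zero_iff k]
  refine forall_congr' fun φ => ?_
  rw [SetLike.mem_coe, RingHom.mem_ker, map_sub, AlgHom.commutes, map_sub]
  rfl

variable [FiniteDimensional k V]

theorem orbitMap_eq_zero_of_mem_dualAnnihilator (hV : HasCoefficientsIn B V) {v : V}
    {X : Module.Dual k B} (hX : X ∈ tangentSpace B)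
    (hXS : X ∈ (LinearMap.ker
      (restrictSubalgebra B (MulAction.stabilizer G v)).toLinearMap).dualAnnihilator) :
    hV.orbitMap v X = 0 := by
  refine hV.orbitMap_eq_iff.2 fun φ => ?_
  have hmem : hV.coeff v φ - algebraMap k B (φ v) ∈
      LinearMap.ker (restrictSubalgebra B (MulAction.stabilizer G v)).toLinearMap := by
    ext s
    exact sub_eq_zero.2 (congrArg φ s.2)
  simpa [apply_algebraMap_of_mem_pointDerivations hX] using
    (Submodule.mem_dualAnnihilator _).1 hXS _ hmem

variable [SMulCommClass G k V]

theorem invariantDerivation_coeff_of_orbitMap_eq_zero (hV : HasCoefficientsIn B V)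
    (hB : HasComul B) {v : V} {X : tangentSpace B} (h : hV.orbitMap v X = 0)
    (φ : Module.Dual k V) : hB.invariantDerivation X (hV.coeff v φ) = 0 := by
  ext g
  rw [hB.invariantDerivation_apply, hV.translate_coeff, ← hV.dual_orbitMap, h, map_zero]
  rfl

theorem invariantDerivation_mem_isotropyIdeal (hV : HasCoefficientsIn B V) (hB : HasComul B)
    {v : V} {X : tangentSpace B} (h : hV.orbitMap v X = 0) {a : B}
    (ha : a ∈ hV.isotropyIdeal v) : hB.invariantDerivation X a ∈ hV.isotropyIdeal v := by
  induction ha using Submodule.span_induction with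
  | mem x hx =>
    obtain ⟨φ, rfl⟩ := hx
    rw [map_sub, hV.invariantDerivation_coeff_of_orbitMap_eq_zero hB h, Derivation.map_algebraMap,
      sub_zero]
    exact zero_mem _
  | zero => rw [map_zero]; exact zero_mem _
  | add x y _ _ hx hy => rw [map_add]; exact add_mem hx hy
  | smul a x hx hDx =>
    rw [smul_eq_mul, Derivation.leibniz]
    exact add_mem (Ideal.mul_mem_left _ _ hDx) (Ideal.mul_mem_right _ _ hx)

end Isotropy

open AffineAlgebraicGroup

variable [AffineAlgebraicGroup k G] [FiniteDimensional k V] [SMulCommClass G k V]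
  [IsAlgClosed k] [CharZero k]

-- In characteristic zero the radical of the isotropy ideal, i.e. the full ideal of the stabilizer,
-- is still stable under the invariant derivations that preserve the isotropy ideal.
theorem mem_dualAnnihilator_of_orbitMap_eq_zero
    (hV : HasCoefficientsIn (coordRing (k := k) (G := G)) V) {v : V}
    {X : Module.Dual k (coordRing (k := k) (G := G))} (hX : X ∈ tangentSpace coordRing)
    (h : hV.orbitMap v X = 0) :
    X ∈ (LinearMap.ker (restrictSubalgebra coordRing
      (MulAction.stabilizer G v)).toLinearMap).dualAnnihilator := by
  refine (Submodule.mem_dualAnnihilator _).2 fun f hf => ?_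
  let I := hV.isotropyIdeal v
  have hfI : f ∈ I.radical := mem_radical fun g hg =>
    congrFun (congrArg Subtype.val hf) ⟨g, (hV.isotropyIdeal_le_ker_evaluation_iff v g).1 hg⟩
  have hDf : hasComul.invariantDerivation ⟨X, hX⟩ f ∈ I.radical :=
    derivation_mem_radical (fun _ => hV.invariantDerivation_mem_isotropyIdeal hasComul h) hfI
  have hI : I ≤ RingHom.ker (evaluation coordRing 1) :=
    (hV.isotropyIdeal_le_ker_evaluation_iff v 1).2 (one_mem _)
  rw [← hasComul.evaluation_one_invariantDerivation ⟨X, hX⟩ f]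
  exact (RingHom.ker_isPrime _).radical_le_iff.2 hI hDf

theorem tangentSpace_inf_ker_orbitMap
    (hV : HasCoefficientsIn (coordRing (k := k) (G := G)) V) (v : V) :
    tangentSpace coordRing ⊓ LinearMap.ker (hV.orbitMap v) =
      (tangentSpace (coordRing.map (restrictFunctions k (MulAction.stabilizer G v)))).map
        (restrictSubalgebra coordRing (MulAction.stabilizer G v)).toLinearMap.dualMap := by
  rw [map_dualMap_tangentSpace_restrict]
  ext X
  exact and_congr_right fun hX => ⟨hV.mem_dualAnnihilator_of_orbitMap_eq_zero hX,
    hV.orbitMap_eq_zero_of_mem_dualAnnihilator hX⟩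

end HasCoefficientsIn

end Stabilizers

section Products

variable {k G V₁ V₂ : Type*} [Field k] [Group G] {B : Subalgebra k (G → k)}
  [AddCommGroup V₁] [Module k V₁] [DistribMulAction G V₁]
  [AddCommGroup V₂] [Module k V₂] [DistribMulAction G V₂]

namespace HasCoefficientsIn

theorem prod (h₁ : HasCoefficientsIn B V₁) (h₂ : HasCoefficientsIn B V₂) :
    HasCoefficientsIn B (V₁ × V₂) := by
  rintro φ ⟨x, y⟩
  convert add_mem (h₁ (φ ∘ₗ LinearMap.inl k V₁ V₂) x) (h₂ (φ ∘ₗ LinearMap.inr k V₁ V₂) y) using 1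
  ext g
  simp [← map_add]

variable [FiniteDimensional k V₁] [FiniteDimensional k V₂]

theorem orbitMap_prod (h₁ : HasCoefficientsIn B V₁) (h₂ : HasCoefficientsIn B V₂)
    (x : V₁) (y : V₂) :
    (h₁.prod h₂).orbitMap (x, y) = (h₁.orbitMap x).prod (h₂.orbitMap y) := by
  ext1 X
  refine (h₁.prod h₂).orbitMap_eq_iff.2 fun φ => ?_
  have hφ (z : V₁ × V₂) : φ z =
      (φ ∘ₗ LinearMap.inl k V₁ V₂) z.1 + (φ ∘ₗ LinearMap.inr k V₁ V₂) z.2 := by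
    simp [← map_add]
  rw [hφ, LinearMap.prod_apply, Function.prod_apply, h₁.dual_orbitMap, h₂.dual_orbitMap, ← map_add]
  congr 1
  ext g
  exact hφ (g • (x, y))

theorem finrank_orbitTangent_swap (h₁ : HasCoefficientsIn B V₁) (h₂ : HasCoefficientsIn B V₂)
    (x : V₁) (y : V₂) :
    Module.finrank k ((h₂.prod h₁).orbitTangent (y, x)) =
      Module.finrank k ((h₁.prod h₂).orbitTangent (x, y)) := by
  rw [orbitTangent, orbitTangent, h₁.orbitMap_prod h₂, h₂.orbitMap_prod h₁]
  refine finrank_map_eq_of_inf_ker_eq _ ?_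
  rw [LinearMap.ker_prod, LinearMap.ker_prod, inf_comm (LinearMap.ker _)]

theorem swap_mem_regularElements_iff [CharZero k] [SMulCommClass G k V₁] [SMulCommClass G k V₂]
    (h₁ : HasCoefficientsIn B V₁) (h₂ : HasCoefficientsIn B V₂) (hfg : B.FG) (hB : HasComul B)
    {z : V₁ × V₂} : z.swap ∈ regularElements k G (V₂ × V₁) ↔ z ∈ regularElements k G (V₁ × V₂) := by
  rw [(h₁.prod h₂).mem_regularElements_iff hfg hB, (h₂.prod h₁).mem_regularElements_iff hfg hB,
    Prod.forall, Prod.forall, forall_comm]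
  simp only [Prod.swap, h₁.finrank_orbitTangent_swap h₂]

end HasCoefficientsIn

end Products

theorem IsGenericIsotropyGroup.exists_isZariskiDense {k G V : Type*} [Field k] [Group G]
    [AddCommGroup V] [Module k V] [MulAction G V] {S : Subgroup G}
    (hS : IsGenericIsotropyGroup k V S) :
    ∃ Ω : Set V, IsZariskiDense k Ω ∧ ∀ v ∈ Ω, ∃ g : G, MulAction.stabilizer G (g • v) = S := by
  obtain ⟨Ω, -, hd, hconj, v₀, hv₀, rfl⟩ := hS
  refine ⟨Ω, hd, fun v hv => ?_⟩
  obtain ⟨g, hg⟩ := hconj v hv v₀ hv₀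
  exact ⟨g, by rw [MulAction.stabilizer_smul_eq_stabilizer_map_conj, hg]⟩

theorem smul_mem_regularElements_iff {k H V : Type*} [Field k] [AddCommGroup V] [Module k V]
    [Group H] [MulAction H V] (h : H) {v : V} :
    h • v ∈ regularElements k H V ↔ v ∈ regularElements k H V := by
  rw [regularElements, Set.mem_ofPred_eq, Set.mem_ofPred_eq, MulAction.orbit_smul]

section GenericIsotropy

open AffineAlgebraicGroup

variable {k : Type*} [Field k] [IsAlgClosed k] [CharZero k]
  {G : Type*} [Group G] [AffineAlgebraicGroup k G] {V₁ V₂ : Type*}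
  [AddCommGroup V₁] [Module k V₁] [FiniteDimensional k V₁]
  [DistribMulAction G V₁] [SMulCommClass G k V₁]
  [AddCommGroup V₂] [Module k V₂] [FiniteDimensional k V₂] [DistribMulAction G V₂]

namespace HasCoefficientsIn

theorem finrank_orbitTangent_eq_of_stabilizer_eq
    (h₁ : HasCoefficientsIn (coordRing (k := k) (G := G)) V₁) {x x' : V₁}
    (h : MulAction.stabilizer G x = MulAction.stabilizer G x') :
    Module.finrank k (h₁.orbitTangent x) = Module.finrank k (h₁.orbitTangent x') :=
  finrank_map_eq_of_inf_ker_eq _ <| by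
    rw [h₁.tangentSpace_inf_ker_orbitMap, h₁.tangentSpace_inf_ker_orbitMap, h]

theorem finrank_orbitTangent_prod
    (h₁ : HasCoefficientsIn (coordRing (k := k) (G := G)) V₁)
    (h₂ : HasCoefficientsIn (coordRing (k := k) (G := G)) V₂)
    (x : V₁) (y : V₂) :
    Module.finrank k ((h₁.prod h₂).orbitTangent (x, y)) =
      Module.finrank k (h₁.orbitTangent x) +
      Module.finrank k ((h₂.restrict (MulAction.stabilizer G x)).orbitTangent y) := by
  rw [orbitTangent, h₁.orbitMap_prod h₂, finrank_map_prod,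
    h₁.tangentSpace_inf_ker_orbitMap, ← orbitTangent_restrict, ← orbitTangent]

variable [SMulCommClass G k V₂]

theorem mem_regularElements_prod_of_stabilizer_eq
    (h₁ : HasCoefficientsIn (coordRing (k := k) (G := G)) V₁)
    (h₂ : HasCoefficientsIn (coordRing (k := k) (G := G)) V₂)
    {S : Subgroup G} (hS : IsGenericIsotropyGroup k V₁ S)
    {x : V₁} (hx : MulAction.stabilizer G x = S) {y : V₂}
    (hy : y ∈ regularElements k S V₂) : (x, y) ∈ regularElements k G (V₁ × V₂) := by
  refine ((h₁.prod h₂).mem_regularElements_iff fg hasComul).2 fun ⟨a, b⟩ => ?_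
  obtain ⟨Ω, hΩ, hΩS⟩ := hS.exists_isZariskiDense
  obtain ⟨a', ha', hle⟩ := hΩ _
    (isZariskiOpen_preimage_affine (LinearMap.inl k V₁ V₂) (0, b)
      ((h₁.prod h₂).isZariskiOpen_le_finrank_orbitTangent
        (Module.finrank k ((h₁.prod h₂).orbitTangent (a, b)))))
    ⟨a, by simp⟩
  obtain ⟨g, hg⟩ := hΩS a' ha'
  calc Module.finrank k ((h₁.prod h₂).orbitTangent (a, b))
      ≤ Module.finrank k ((h₁.prod h₂).orbitTangent (a', b)) := by simpa using hle
    _ = Module.finrank k ((h₁.prod h₂).orbitTangent (g • a', g • b)) :=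
      ((h₁.prod h₂).finrank_orbitTangent_smul fg hasComul g (a', b)).symm
    _ = Module.finrank k (h₁.orbitTangent x) +
        Module.finrank k ((h₂.restrict S).orbitTangent (g • b)) := by
      rw [h₁.finrank_orbitTangent_prod h₂, hg,
        h₁.finrank_orbitTangent_eq_of_stabilizer_eq (hg.trans hx.symm)]
    _ ≤ Module.finrank k (h₁.orbitTangent x) +
        Module.finrank k ((h₂.restrict S).orbitTangent y) := by
      gcongr
      exact ((h₂.restrict S).mem_regularElements_iff (fg.map _) (hasComul.restrict S)).1 hy _
    _ = Module.finrank k ((h₁.prod h₂).orbitTangent (x, y)) := by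
      rw [h₁.finrank_orbitTangent_prod h₂, hx]

theorem exists_zero_mem_regularElements
    (h₁ : HasCoefficientsIn (coordRing (k := k) (G := G)) V₁)
    (h₂ : HasCoefficientsIn (coordRing (k := k) (G := G)) V₂)
    {S : Subgroup G} (hS : IsGenericIsotropyGroup k V₁ S)
    (hcodim : CodimensionCondition 2 k S V₂) {f : V₁ × V₂ → k}
    (hf : f ∈ regularFunctions k (V₁ × V₂)) {x : V₁} {y y' : V₂} (hne : f (x, y) ≠ f (x, y')) :
    ∃ z ∈ regularElements k G (V₁ × V₂), f z = 0 := by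
  obtain ⟨Ω, hΩ, hΩS⟩ := hS.exists_isZariskiDense
  have hslice (y : V₂) : (fun x => f (x, y)) ∈ regularFunctions k V₁ := by
    simpa using comp_affine_mem_regularFunctions (LinearMap.inl k V₁ V₂) (0, y) hf
  have hopen : IsZariskiOpen k {x : V₁ | f (x, y) ≠ f (x, y')} :=
    isZariskiOpen_iff_forall_exists.2 fun v hv =>
      ⟨_, sub_mem (hslice y) (hslice y'), sub_ne_zero.2 hv, fun w hw => sub_ne_zero.1 hw⟩
  obtain ⟨x', hx', hne'⟩ := hΩ _ hopen ⟨x, hne⟩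
  obtain ⟨g, hg⟩ := hΩS x' hx'
  have hF : (fun w : V₂ => f (x', g⁻¹ • w)) ∈ regularFunctions k V₂ := by
    simpa using comp_affine_mem_regularFunctions
      (LinearMap.inr k V₁ V₂ ∘ₗ DistribSMul.toLinearMap k V₂ g⁻¹) (x', 0) hf
  by_contra! hzero
  refine not_zariskiDim_add_two_le_of_zero_subset hF ⟨g • y, g • y', by simpa using hne'⟩
    (Y := (regularElements k S V₂)ᶜ) (fun w hw hwreg => hzero (x', g⁻¹ • w) ?_ hw) hcodim
  rw [← smul_mem_regularElements_iff g]
  simpa using h₁.mem_regularElements_prod_of_stabilizer_eq h₂ hS hg hwreg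

end HasCoefficientsIn

end GenericIsotropy

theorem mainTheorem7
    {k : Type*} [Field k] [IsAlgClosed k] [CharZero k]
    {G : Type*} [Group G] [AffineAlgebraicGroup k G]
    {V₁ V₂ : Type*}
    [AddCommGroup V₁] [Module k V₁] [FiniteDimensional k V₁]
    [DistribMulAction G V₁] [SMulCommClass G k V₁]
    [AddCommGroup V₂] [Module k V₂] [FiniteDimensional k V₂]
    [DistribMulAction G V₂] [SMulCommClass G k V₂]
    (hV₁ : IsRationalAction k G V₁) (hV₂ : IsRationalAction k G V₂)
    (S₁ S₂ : Subgroup G)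
    (hS₁ : IsGenericIsotropyGroup k V₁ S₁) (hS₂ : IsGenericIsotropyGroup k V₂ S₂)
    (h₁₂ : CodimensionCondition 2 k S₁ V₂) (h₂₁ : CodimensionCondition 2 k S₂ V₁) :
    CodimensionCondition 2 k G (V₁ × V₂) := by
  have hfg := AffineAlgebraicGroup.fg (k := k) (G := G)
  have hcomul := AffineAlgebraicGroup.hasComul (k := k) (G := G)
  have h₁ : HasCoefficientsIn AffineAlgebraicGroup.coordRing V₁ := hV₁
  have h₂ : HasCoefficientsIn AffineAlgebraicGroup.coordRing V₂ := hV₂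
  by_contra hcodim
  obtain ⟨f, hf, ⟨⟨x, y⟩, ⟨x', y'⟩, hne⟩, hfreg⟩ :=
    exists_zero_subset_of_not_zariskiDim_add_two_le (Z := (regularElements k G (V₁ × V₂))ᶜ)
      (by simpa using (h₁.prod h₂).isZariskiOpen_regularElements hfg hcomul)
      (by simpa using (h₁.prod h₂).regularElements_nonempty hfg hcomul) hcodim
  by_cases hxy : f (x, y) = f (x, y')
  · have hf' : f ∘ Prod.swap ∈ regularFunctions k (V₂ × V₁) :=
      comp_linear_mem_regularFunctions (LinearEquiv.prodComm k V₂ V₁).toLinearMap hf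
    obtain ⟨z, hz, hfz⟩ := h₂.exists_zero_mem_regularElements h₁ hS₂ h₂₁ hf' (hxy ▸ hne)
    exact hfreg z.swap hfz ((h₂.swap_mem_regularElements_iff h₁ hfg hcomul).2 hz)
  · obtain ⟨z, hz, hfz⟩ := h₁.exists_zero_mem_regularElements h₂ hS₁ h₁₂ hf hxy
    exact hfreg z hfz hz
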